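/- Let $n\le 2$, let $\Omega\subset\mathbb R^n$ be a bounded open convex set (such a set automatically has Lipschitz boundary), $Y$ a real normed vector space, $T:L^2(\Omega)\to Y$ a bounded linear operator, $v\in Y$, and $\alpha_1,\alpha_2>0$. Let $\theta:\Omega\to[0,1]$ be measurable, $\Omega_1=\{x\in\Omega:\theta(x)=1\}$ and $\Omega_1^c=\Omega\setminus\Omega_1$. For $u\in L^2(\Omega)$ put $$W_{0,\theta}(u)=\sup_{\vec\nu\in\mathcal V_\theta}\int_\Omega -u\,\mathrm{div}(\theta\vec\nu)\,dx,\qquad \mathcal V_\theta=\{\vec\nu:\Omega\to\mathbb R^n:\ \theta\vec\nu\in C^1_0(\Omega;\mathbb R^n),\ |\vec\nu(x)|\le 1\ \forall x\in\Omega\},$$ where $C^1_0$ denotes the compactly supported $C^1$ fields, and $$F_\theta(u)=\|Tu-v\|_Y^2+\alpha_1\|\sqrt{1-\theta}\,u\|_{L^2(\Omega)}^2+\alpha_2W_{0,\theta}(u)\in[0,\infty].$$ For a set $A\subseteq\Omega$, $u\in BV(A)$ means that $u\in L^1(A)$ and $\sup\{\int_A -u\,\mathrm{div}\,\vec\nu\,dx:\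 \vec\nu\in C^1_0(A;\mathbb R^n),\ |\vec\nu|\le1\}<\infty$, where $C^1_0(A;\mathbb R^n)$ denotes the $C^1$ fields on $\mathbb R^n$ with compact support contained in $A$. Assume that $1/\theta$ is bounded on $\Omega_1^c$ (that is, there is $c>0$ with $\theta(x)\ge c$ for every $x\in\Omega_1^c$), that $1/(1-\theta)\in L^1(\Omega_1^c)$, and that $T\chi_\Omega\ne0$. Then $F_\theta$ has a global minimizer $u^*$ over $L^2(\Omega)$ with $u^*\in BV(\Omega_1^c)$, and in fact $u^*\in BV(\Omega)$. If moreover $Y$ is strictly convex (for example a Hilbert space) and the null space of $T$ contains no nonzero function vanishing a.e. on $\Omega_1^c$ (that is, $Tu=0$ and $u\neq 0$ imply $u|_{\Omega_1^c}\neq0$), then the global minimizer of $F_\theta$ over $L^2(\Omega)$ is unique. -/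

import Mathlib

open MeasureTheory

noncomputable section

namespace L2BV

/-- `ℝⁿ` with its Euclidean norm. -/
abbrev Space (n : ℕ) : Type := EuclideanSpace ℝ (Fin n)

/-- The Hilbert space `L²(Ω)` of real valued functions. -/
abbrev L2 {n : ℕ} (Ω : Set (Space n)) : Type := Lp ℝ 2 (volume.restrict Ω)

/-- The divergence `∑ᵢ ∂ᵢ φᵢ` of a vector field. -/
def divergence {n : ℕ} (φ : Space n → Space n) (x : Space n) : ℝ :=
  ∑ i : Fin n, (fderiv ℝ φ x (EuclideanSpace.single i 1)) i

/-- `φ ∈ C¹₀(A; ℝⁿ)`: continuously differentiable with compact support contained in `A`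
(fields on `A` are extended by zero to `ℝⁿ`). -/
def IsTestField {n : ℕ} (A : Set (Space n)) (φ : Space n → Space n) : Prop :=
  ContDiff ℝ 1 φ ∧ HasCompactSupport φ ∧ tsupport φ ⊆ A

/-- The class `𝒱 = {ν : ν ∈ C¹₀(A; ℝⁿ), |ν(x)| ≤ 1 for all x ∈ A}`. -/
def fields {n : ℕ} (A : Set (Space n)) : Set (Space n → Space n) :=
  {ν | IsTestField A ν ∧ ∀ x ∈ A, ‖ν x‖ ≤ 1}

/-- The bounded variation seminorm `J₀(u) = sup_{ν ∈ 𝒱} ∫_A -u div ν dx` on the set `A`. -/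
def J0 {n : ℕ} (A : Set (Space n)) (u : Space n → ℝ) : EReal :=
  ⨆ ν ∈ fields A, ((∫ x in A, -(u x) * divergence ν x : ℝ) : EReal)

/-- `u ∈ BV(A)`: `u` is integrable on `A` and its bounded variation seminorm on `A` is finite. -/
def MemBV {n : ℕ} (A : Set (Space n)) (u : Space n → ℝ) : Prop :=
  IntegrableOn u A volume ∧ J0 A u < ⊤

/-- The class `𝒱_θ = {ν : θν ∈ C¹₀(Ω; ℝⁿ), |ν(x)| ≤ 1 for all x ∈ Ω}`. -/
def weightedFields {n : ℕ} (Ω : Set (Space n)) (θ : Space n → ℝ) :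
    Set (Space n → Space n) :=
  {ν | IsTestField Ω (fun x => θ x • ν x) ∧ ∀ x ∈ Ω, ‖ν x‖ ≤ 1}

/-- The functional `W_{0,θ}(u) = sup_{ν ∈ 𝒱_θ} ∫_Ω -u div(θν) dx`, with extended real values. -/
def W0 {n : ℕ} (Ω : Set (Space n)) (θ : Space n → ℝ) (u : Space n → ℝ) : EReal :=
  ⨆ ν ∈ weightedFields Ω θ,
    ((∫ x in Ω, -(u x) * divergence (fun y => θ y • ν y) x : ℝ) : EReal)

/-- The functional
`F_θ(u) = ‖Tu - v‖² + α₁ ‖√(1-θ) u‖²_{L²(Ω)} + α₂ W_{0,θ}(u)` on `L²(Ω)`. -/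
def F {n : ℕ} (Ω : Set (Space n)) {Y : Type*} [NormedAddCommGroup Y] [NormedSpace ℝ Y]
    (T : L2 Ω →L[ℝ] Y) (v : Y) (α₁ α₂ : ℝ) (θ : Space n → ℝ) (u : L2 Ω) : EReal :=
  ((‖T u - v‖ ^ 2 + α₁ * ∫ x in Ω, (√(1 - θ x) * u x) ^ 2 : ℝ) : EReal)
    + (α₂ : EReal) * W0 Ω θ u

/-- The region `Ω₁ = {x ∈ Ω : θ(x) = 1}`. -/
def regionOne {n : ℕ} (Ω : Set (Space n)) (θ : Space n → ℝ) : Set (Space n) :=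
  {x | x ∈ Ω ∧ θ x = 1}

theorem restrict_self_ne_top {n : ℕ} {Ω : Set (Space n)} (hb : Bornology.IsBounded Ω) :
    (volume.restrict Ω) Ω ≠ ⊤ := by
  rw [Measure.restrict_apply_self]
  exact hb.measure_lt_top.ne

/-- The characteristic function `χ_Ω` as an element of `L²(Ω)`, for a bounded open set `Ω`. -/
def chi {n : ℕ} {Ω : Set (Space n)} (ho : IsOpen Ω) (hb : Bornology.IsBounded Ω) : L2 Ω :=
  indicatorConstLp 2 ho.measurableSet (restrict_self_ne_top hb) (1 : ℝ)

end L2BV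

end

/-!
The functional `F_θ` is minimized by the direct method. It is convex and lower semicontinuous, being
the sum of a continuous convex function and a supremum of continuous linear functionals
(`isClosed_sublevel_F`, `convex_sublevel_F`); a nonnegative function on a Hilbert space with closed,
convex and bounded sublevel sets attains its minimum (`exists_minimizer_of_sublevel`). So everything
rests on coercivity in `L²`.

The weight `θ` is bounded below by some `c > 0` on all of `Ω`, so that every `C¹₀` field bounded by
`c` is admissible for `W_{0,θ}` and a bound on `F_θ` bounds the variation `J₀` on `Ω`
(`J0_le_of_F_le`). The Poincaré–Sobolev inequality `‖u - m‖_{L²} ≤ C J₀(u)`, valid for some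
constant `m` since `n ≤ 2` (`exists_norm_sub_smul_chi_le`), then bounds `u` up to constants, and the
constants are controlled by the data term because `T χ_Ω ≠ 0` (`isBounded_sublevel_F`).

The Poincaré–Sobolev inequality is proved for `C¹` functions `w` first. In the plane, a point `x` of
a convex set `D` is joined to a fixed reference point by a segment with direction `e`, followed by
two segments on lines chosen such that the variation of `w` along them is controlled. Hence
`|w x - c|` is at most the variation of `w` along the line through `x` with direction `e`, plus a
multiple of the total variation `V` (`enorm_sub_le_of_cross`). The same holds with a second,
independent direction `e'`. The product of the two bounds dominates `|w x - c|²`; in coordinates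
along `e` and `e'` its factors depend on different variables, so its integral over `D` is bounded by
a multiple of `V²` (`exists_lintegral_mul_lineVariation_le`). By compactness finitely many pairs of
directions suffice. For functions of bounded variation the inequality is obtained by mollification
on inner parallel sets, where mollifying does not increase the variation
(`lintegral_fderiv_mollify_le`), and Fatou's lemma.

For uniqueness, the midpoint of two minimizers would have a strictly smaller value unless their
images under `T` coincide, by strict convexity of `Y`, and they agree wherever `θ < 1`
(`minimizers_agree`). Their difference is then in the null space of `T` and vanishes on the
complement of `Ω₁`.
-/

open Filter Topology
open scoped ENNReal Convolution

/-! ### The direct method in a Hilbert space -/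

/-- A decreasing sequence of nonempty, closed, convex, bounded subsets of a Hilbert space has a
common point: the points of least norm form a Cauchy sequence by the parallelogram law. -/
theorem exists_forall_mem_of_antitone_closed_convex {H : Type*} [NormedAddCommGroup H]
    [InnerProductSpace ℝ H] [CompleteSpace H] {S : ℕ → Set H} (hanti : Antitone S)
    (hne : ∀ k, (S k).Nonempty) (hcl : ∀ k, IsClosed (S k)) (hconv : ∀ k, Convex ℝ (S k))
    (hbdd : Bornology.IsBounded (S 0)) : ∃ x, ∀ k, x ∈ S k := by
  have hmin : ∀ k, ∃ x ∈ S k, ∀ w ∈ S k, ‖x‖ ≤ ‖w‖ := by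
    intro k
    obtain ⟨x, hx, hx'⟩ := exists_norm_eq_iInf_of_complete_convex (hne k)
      (hcl k).isComplete (hconv k) 0
    refine ⟨x, hx, fun w hw => ?_⟩
    simp only [zero_sub, norm_neg] at hx'
    rw [hx']
    exact ciInf_le (f := fun w : S k => ‖(w : H)‖)
      ⟨0, by rintro _ ⟨w, rfl⟩; exact norm_nonneg _⟩ ⟨w, hw⟩
  choose x hxS hxmin using hmin
  obtain ⟨R, hR⟩ := hbdd.exists_norm_le
  have hmono : Monotone fun k => ‖x k‖ ^ 2 := fun k l hkl => by
    have := hxmin k (x l) (hanti hkl (hxS l))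
    dsimp only
    gcongr
  have hba : BddAbove (Set.range fun k => ‖x k‖ ^ 2) := by
    refine ⟨R ^ 2, ?_⟩
    rintro _ ⟨k, rfl⟩
    have := hR (x k) (hanti (Nat.zero_le k) (hxS k))
    dsimp only
    gcongr
  have hlim := tendsto_atTop_ciSup hmono hba
  set L := ⨆ k, ‖x k‖ ^ 2
  have hcau : CauchySeq x := by
    refine cauchySeq_of_le_tendsto_0' (fun k => √(2 * (L - ‖x k‖ ^ 2))) (fun k l hkl => ?_) ?_
    · rw [dist_eq_norm]
      refine Real.le_sqrt_of_sq_le ?_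
      have hmid : (1 / 2 : ℝ) • x k + (1 / 2 : ℝ) • x l ∈ S k :=
        hconv k (hxS k) (hanti hkl (hxS l)) (by norm_num) (by norm_num) (by norm_num)
      have h1 := hxmin k _ hmid
      rw [← smul_add, norm_smul, Real.norm_of_nonneg (by norm_num)] at h1
      have h2 := parallelogram_law_with_norm ℝ (x k) (x l)
      have h3 : ‖x l‖ ^ 2 ≤ L := le_ciSup hba l
      nlinarith [norm_nonneg (x k), norm_nonneg (x k + x l)]
    · have : Tendsto (fun k => √(2 * (L - ‖x k‖ ^ 2))) atTop (𝓝 (√(2 * (L - L)))) :=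
        ((hlim.const_sub L).const_mul 2).sqrt
      simpa using this
  obtain ⟨y, hy⟩ := cauchySeq_tendsto_of_complete hcau
  refine ⟨y, fun k => (hcl k).mem_of_tendsto hy ?_⟩
  filter_upwards [eventually_ge_atTop k] with l hl using hanti hl (hxS l)

/-- The direct method in a Hilbert space: a nonnegative, somewhere finite functional whose real
sublevel sets are closed, convex and bounded attains its minimum. -/
theorem exists_minimizer_of_sublevel {H : Type*} [NormedAddCommGroup H]
    [InnerProductSpace ℝ H] [CompleteSpace H] {G : H → EReal}
    (hcl : ∀ c : ℝ, IsClosed {u | G u ≤ c}) (hconv : ∀ c : ℝ, Convex ℝ {u | G u ≤ c})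
    (hbdd : ∀ c : ℝ, Bornology.IsBounded {u | G u ≤ c}) (hnonneg : ∀ u, 0 ≤ G u)
    {u₀ : H} (hu₀ : G u₀ < ⊤) : ∃ u, ∀ w, G u ≤ G w := by
  obtain ⟨r, hr⟩ : ∃ r : ℝ, (r : EReal) = ⨅ w, G w := by
    refine ⟨(⨅ w, G w).toReal, EReal.coe_toReal ?_ ?_⟩
    · exact ((iInf_le _ u₀).trans_lt hu₀).ne
    · exact (EReal.bot_lt_zero.trans_le (le_iInf hnonneg)).ne'
  obtain ⟨x, hx⟩ := exists_forall_mem_of_antitone_closed_convex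
    (S := fun k : ℕ => {u | G u ≤ ((r + 1 / ((k : ℝ) + 1) : ℝ) : EReal)})
    (fun k l hkl u hu => le_trans (show G u ≤ _ from hu) (EReal.coe_le_coe_iff.2 (by gcongr)))
    (fun k => by
      have : (⨅ w, G w) < ((r + 1 / ((k : ℝ) + 1) : ℝ) : EReal) := by
        rw [← hr, EReal.coe_lt_coe_iff]
        have : (0 : ℝ) < 1 / ((k : ℝ) + 1) := by positivity
        linarith
      obtain ⟨w, hw⟩ := iInf_lt_iff.1 this
      exact ⟨w, hw.le⟩)
    (fun k => hcl _) (fun k => hconv _) (hbdd _)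
  refine ⟨x, fun w => le_trans ?_ (hr.trans_le (iInf_le _ w))⟩
  have hlim : Tendsto (fun k : ℕ => ((r + 1 / ((k : ℝ) + 1) : ℝ) : EReal)) atTop
      (𝓝 (r : EReal)) := by
    refine EReal.tendsto_coe.2 ?_
    simpa using tendsto_one_div_add_atTop_nhds_zero_nat.const_add r
  exact ge_of_tendsto' hlim hx

/-! ### The functional and its sublevel sets -/

namespace L2BV

theorem IsTestField.continuous_divergence {n : ℕ} {A : Set (Space n)} {φ : Space n → Space n}
    (h : IsTestField A φ) : Continuous (divergence φ) := by
  have := h.1.continuous_fderiv one_ne_zero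
  unfold divergence
  fun_prop

theorem divergence_eq_zero_of_notMem_tsupport {n : ℕ} {φ : Space n → Space n} {x : Space n}
    (hx : x ∉ tsupport φ) : divergence φ x = 0 := by
  have : fderiv ℝ φ x = 0 := by
    by_contra hne
    exact hx (support_fderiv_subset ℝ hne)
  simp [divergence, this]

theorem IsTestField.hasCompactSupport_divergence {n : ℕ} {A : Set (Space n)}
    {φ : Space n → Space n} (h : IsTestField A φ) : HasCompactSupport (divergence φ) :=
  HasCompactSupport.intro h.2.1 fun _ hx => divergence_eq_zero_of_notMem_tsupport hx

theorem zero_mem_weightedFields {n : ℕ} (Ω : Set (Space n)) (θ : Space n → ℝ) :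
    (0 : Space n → Space n) ∈ weightedFields Ω θ := by
  refine ⟨⟨?_, ?_, ?_⟩, by simp⟩
  · simpa using contDiff_const
  · exact HasCompactSupport.intro isCompact_empty fun x _ => by simp
  · simp

theorem W0_nonneg {n : ℕ} (Ω : Set (Space n)) (θ u : Space n → ℝ) : 0 ≤ W0 Ω θ u := by
  refine le_iSup₂_of_le 0 (zero_mem_weightedFields Ω θ) ?_
  simp [divergence]

/-- Testing against the divergence of a fixed field is a continuous linear functional on `L²`. -/
theorem exists_clm_eq_integral_divergence {n : ℕ} {A Ω : Set (Space n)} {φ : Space n → Space n}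
    (h : IsTestField A φ) : ∃ ℓ : L2 Ω →L[ℝ] ℝ, ∀ u : L2 Ω,
      ℓ u = ∫ x in Ω, -(u x) * divergence φ x := by
  have hm : MemLp (divergence φ) 2 (volume.restrict Ω) :=
    (h.continuous_divergence.memLp_of_hasCompactSupport
      h.hasCompactSupport_divergence).restrict Ω
  refine ⟨-(innerSL ℝ hm.toLp), fun u => ?_⟩
  simp only [neg_apply, innerSL_apply_apply, L2.inner_def]
  rw [← integral_neg]
  refine integral_congr_ae ?_
  filter_upwards [hm.coeFn_toLp] with x hx
  simp [hx]

/-- The weighted norm `‖√(1-θ) u‖` is the norm of `S u` for a bounded multiplication operator. -/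
theorem exists_clm_mul_sqrt {n : ℕ} {Ω : Set (Space n)} (hΩ : MeasurableSet Ω)
    {θ : Space n → ℝ} (hθm : AEMeasurable θ (volume.restrict Ω))
    (hθ : ∀ x ∈ Ω, θ x ∈ Set.Icc (0 : ℝ) 1) : ∃ S : L2 Ω →L[ℝ] L2 Ω,
      (∀ u : L2 Ω, S u =ᵐ[volume.restrict Ω] fun x => √(1 - θ x) * u x) ∧
      ∀ u : L2 Ω, ∫ x in Ω, (√(1 - θ x) * u x) ^ 2 = ‖S u‖ ^ 2 := by
  have hm : MemLp (fun x => √(1 - θ x)) ⊤ (volume.restrict Ω) := by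
    refine memLp_top_of_bound (C := 1) ?_ ?_
    · exact (Real.continuous_sqrt.measurable.comp_aemeasurable
        (hθm.const_sub 1)).aestronglyMeasurable
    · filter_upwards [ae_restrict_mem hΩ] with x hx
      rw [Real.norm_of_nonneg (Real.sqrt_nonneg _)]
      exact Real.sqrt_le_one.2 (by linarith [(hθ x hx).1])
  have hS : ∀ u : L2 Ω, (ContinuousLinearMap.mul ℝ ℝ).holderL (volume.restrict Ω) ⊤ 2 2 hm.toLp u
      =ᵐ[volume.restrict Ω] fun x => √(1 - θ x) * u x := by
    intro u
    rw [ContinuousLinearMap.holderL_apply_apply]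
    filter_upwards [ContinuousLinearMap.coeFn_holder (r := 2) (ContinuousLinearMap.mul ℝ ℝ)
      hm.toLp u, hm.coeFn_toLp] with x hx hx'
    simp [hx, hx']
  refine ⟨(ContinuousLinearMap.mul ℝ ℝ).holderL (volume.restrict Ω) ⊤ 2 2 hm.toLp, hS,
    fun u => ?_⟩
  rw [← real_inner_self_eq_norm_sq, L2.inner_def]
  refine integral_congr_ae ?_
  filter_upwards [hS u] with x hx
  rw [real_inner_self_eq_norm_sq, hx, Real.norm_eq_abs, sq_abs]

/-- A real upper bound on `F_θ` decouples into one bound for each admissible field. -/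
theorem F_le_coe_iff {n : ℕ} {Ω : Set (Space n)} {Y : Type*} [NormedAddCommGroup Y]
    [NormedSpace ℝ Y] {T : L2 Ω →L[ℝ] Y} {v : Y} {α₁ α₂ : ℝ} (hα₂ : 0 < α₂)
    {θ : Space n → ℝ} {u : L2 Ω} {c : ℝ} :
    F Ω T v α₁ α₂ θ u ≤ c ↔ ∀ ν ∈ weightedFields Ω θ,
      ‖T u - v‖ ^ 2 + α₁ * (∫ x in Ω, (√(1 - θ x) * u x) ^ 2) +
        α₂ * (∫ x in Ω, -(u x) * divergence (fun y => θ y • ν y) x) ≤ c := by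
  set q := ‖T u - v‖ ^ 2 + α₁ * ∫ x in Ω, (√(1 - θ x) * u x) ^ 2 with hq
  have h1 : F Ω T v α₁ α₂ θ u ≤ c ↔ W0 Ω θ u ≤ ((c - q) / α₂ : ℝ) := by
    have hnb : W0 Ω θ u ≠ ⊥ := (EReal.bot_lt_zero.trans_le (W0_nonneg Ω θ u)).ne'
    rw [F, ← hq]
    revert hnb
    induction W0 Ω θ u with
    | bot => simp
    | top => simp [EReal.coe_mul_top_of_pos hα₂]
    | coe w =>
      intro _
      rw [← EReal.coe_mul, ← EReal.coe_add, EReal.coe_le_coe_iff, EReal.coe_le_coe_iff,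
        le_div_iff₀ hα₂]
      constructor <;> intro h <;> linarith
  rw [h1, W0, iSup₂_le_iff]
  refine forall₂_congr fun ν _ => ?_
  rw [EReal.coe_le_coe_iff, le_div_iff₀ hα₂]
  constructor <;> intro h <;> linarith

theorem convex_combo_sq_norm_le {E : Type*} [SeminormedAddCommGroup E] [NormedSpace ℝ E]
    (x y : E) {a b : ℝ} (ha : 0 ≤ a) (hb : 0 ≤ b) (hab : a + b = 1) :
    ‖a • x + b • y‖ ^ 2 ≤ a * ‖x‖ ^ 2 + b * ‖y‖ ^ 2 := by
  have h := (convexOn_univ_norm.pow (fun x _ => norm_nonneg x) 2 : ConvexOn ℝ Set.univ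
    fun x : E => ‖x‖ ^ 2)
  exact h.2 trivial trivial ha hb hab

theorem isClosed_sublevel_F {n : ℕ} {Ω : Set (Space n)} (hΩ : MeasurableSet Ω) {Y : Type*}
    [NormedAddCommGroup Y] [NormedSpace ℝ Y] (T : L2 Ω →L[ℝ] Y) (v : Y) (α₁ : ℝ) {α₂ : ℝ}
    (hα₂ : 0 < α₂) {θ : Space n → ℝ} (hθm : AEMeasurable θ (volume.restrict Ω))
    (hθ : ∀ x ∈ Ω, θ x ∈ Set.Icc (0 : ℝ) 1) (c : ℝ) :
    IsClosed {u | F Ω T v α₁ α₂ θ u ≤ c} := by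
  obtain ⟨S, -, hS⟩ := exists_clm_mul_sqrt hΩ hθm hθ
  simp only [F_le_coe_iff hα₂, Set.ofPred_forall, hS]
  refine isClosed_biInter fun ν hν => ?_
  obtain ⟨ℓ, hℓ⟩ := exists_clm_eq_integral_divergence (Ω := Ω) hν.1
  simp only [← hℓ]
  exact isClosed_le (by fun_prop) continuous_const

theorem convex_sublevel_F {n : ℕ} {Ω : Set (Space n)} (hΩ : MeasurableSet Ω) {Y : Type*}
    [NormedAddCommGroup Y] [NormedSpace ℝ Y] (T : L2 Ω →L[ℝ] Y) (v : Y) {α₁ α₂ : ℝ}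
    (hα₁ : 0 < α₁) (hα₂ : 0 < α₂) {θ : Space n → ℝ} (hθm : AEMeasurable θ (volume.restrict Ω))
    (hθ : ∀ x ∈ Ω, θ x ∈ Set.Icc (0 : ℝ) 1) (c : ℝ) :
    Convex ℝ {u | F Ω T v α₁ α₂ θ u ≤ c} := by
  obtain ⟨S, -, hS⟩ := exists_clm_mul_sqrt hΩ hθm hθ
  intro u hu w hw a b ha hb hab
  simp only [Set.mem_ofPred_eq, F_le_coe_iff hα₂, hS] at hu hw ⊢
  intro ν hν
  obtain ⟨ℓ, hℓ⟩ := exists_clm_eq_integral_divergence (Ω := Ω) hν.1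
  specialize hu ν hν
  specialize hw ν hν
  rw [← hℓ] at hu hw ⊢
  have h1 := convex_combo_sq_norm_le (T u - v) (T w - v) ha hb hab
  have h2 := convex_combo_sq_norm_le (S u) (S w) ha hb hab
  have e1 : T (a • u + b • w) - v = a • (T u - v) + b • (T w - v) := by
    have : v = a • v + b • v := by rw [← add_smul, hab, one_smul]
    simp only [map_add, map_smul, smul_sub]
    nth_rw 1 [this]
    abel
  rw [e1, map_add, map_smul, map_smul, map_add, map_smul, map_smul]
  have h3 := mul_le_mul_of_nonneg_left h2 hα₁.le
  have h4 := mul_le_mul_of_nonneg_left hu ha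
  have h5 := mul_le_mul_of_nonneg_left hw hb
  have : c = a * c + b * c := by rw [← add_mul, hab, one_mul]
  simp only [smul_eq_mul]
  linarith

theorem F_nonneg {n : ℕ} {Ω : Set (Space n)} {Y : Type*} [NormedAddCommGroup Y]
    [NormedSpace ℝ Y] (T : L2 Ω →L[ℝ] Y) (v : Y) {α₁ α₂ : ℝ} (hα₁ : 0 < α₁) (hα₂ : 0 < α₂)
    (θ : Space n → ℝ) (u : L2 Ω) : 0 ≤ F Ω T v α₁ α₂ θ u := by
  refine add_nonneg ?_ (mul_nonneg (EReal.coe_nonneg.2 hα₂.le) (W0_nonneg Ω θ u))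
  rw [EReal.coe_nonneg]
  have : 0 ≤ ∫ x in Ω, (√(1 - θ x) * u x) ^ 2 := integral_nonneg fun x => sq_nonneg _
  positivity

theorem F_zero_lt_top {n : ℕ} {Ω : Set (Space n)} (hΩ : MeasurableSet Ω) {Y : Type*}
    [NormedAddCommGroup Y] [NormedSpace ℝ Y] (T : L2 Ω →L[ℝ] Y) (v : Y) (α₁ : ℝ) {α₂ : ℝ}
    (hα₂ : 0 < α₂) {θ : Space n → ℝ} (hθm : AEMeasurable θ (volume.restrict Ω))
    (hθ : ∀ x ∈ Ω, θ x ∈ Set.Icc (0 : ℝ) 1) : F Ω T v α₁ α₂ θ 0 < ⊤ := by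
  obtain ⟨S, -, hS⟩ := exists_clm_mul_sqrt hΩ hθm hθ
  refine lt_of_le_of_lt ((F_le_coe_iff hα₂ (c := ‖v‖ ^ 2)).2 fun ν hν => ?_) (EReal.coe_lt_top _)
  obtain ⟨ℓ, hℓ⟩ := exists_clm_eq_integral_divergence (Ω := Ω) hν.1
  rw [hS, ← hℓ]
  simp

/-- If `θ ≥ c` then every `C¹₀` field bounded by `c` is admissible for `W_{0,θ}`, so that a bound
on `F_θ` bounds the variation. -/
theorem J0_le_of_F_le {n : ℕ} {Ω : Set (Space n)} {Y : Type*} [NormedAddCommGroup Y]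
    [NormedSpace ℝ Y] {T : L2 Ω →L[ℝ] Y} {v : Y} {α₁ α₂ : ℝ} (hα₁ : 0 < α₁) (hα₂ : 0 < α₂)
    {θ : Space n → ℝ} {c : ℝ} (hc : 0 < c) (hθc : ∀ x ∈ Ω, c ≤ θ x) {u : L2 Ω} {M : ℝ}
    (hF : F Ω T v α₁ α₂ θ u ≤ M) : J0 Ω u ≤ (M / (α₂ * c) : ℝ) := by
  classical
  refine iSup₂_le fun φ hφ => ?_
  rw [EReal.coe_le_coe_iff]
  have hφ0 : ∀ x ∉ Ω, φ x = 0 := fun x hx => image_eq_zero_of_notMem_tsupport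
    fun h => hx (hφ.1.2.2 h)
  -- the admissible weighted field is `ν = c φ / θ`
  set ν : Space n → Space n := fun x => (c / θ x) • φ x with hν
  have hθν : (fun x => θ x • ν x) = c • φ := by
    funext x
    by_cases hx : x ∈ Ω
    · have := (hc.trans_le (hθc x hx)).ne'
      simp only [hν, smul_smul, Pi.smul_apply]
      congr 1
      field_simp
    · simp [hν, hφ0 x hx]
  have hmem : ν ∈ weightedFields Ω θ := by
    refine ⟨?_, fun x hx => ?_⟩
    · rw [hθν]
      exact ⟨hφ.1.1.const_smul c, hφ.1.2.1.smul_left (f := fun _ => c),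
        (closure_mono (Function.support_const_smul_subset c φ)).trans hφ.1.2.2⟩
    · have hpos := hc.trans_le (hθc x hx)
      rw [hν, norm_smul, Real.norm_of_nonneg (div_pos hc hpos).le]
      exact mul_le_one₀ ((div_le_one hpos).2 (hθc x hx)) (norm_nonneg _) (hφ.2 x hx)
  have h := (F_le_coe_iff hα₂).1 hF ν hmem
  rw [hθν] at h
  have hdiv : ∀ x, divergence (c • φ) x = c * divergence φ x := fun x => by
    simp only [divergence, Finset.mul_sum]
    refine Finset.sum_congr rfl fun i _ => ?_
    rw [fderiv_const_smul ((hφ.1.1.differentiable one_ne_zero) x)]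
    simp
  have hI : ∫ x in Ω, -(u x) * divergence (c • φ) x
      = c * ∫ x in Ω, -(u x) * divergence φ x := by
    rw [← integral_const_mul]
    refine integral_congr_ae (ae_of_all _ fun x => ?_)
    simp only [hdiv]
    ring
  rw [hI] at h
  have : 0 ≤ ∫ x in Ω, (√(1 - θ x) * u x) ^ 2 := integral_nonneg fun x => sq_nonneg _
  rw [le_div_iff₀ (by positivity)]
  nlinarith [sq_nonneg ‖T u - v‖, mul_nonneg hα₁.le this]

/-- The variation only decreases when the set shrinks, since a field supported in the smaller set
is also admissible for the larger one. -/
theorem J0_mono {n : ℕ} {A Ω : Set (Space n)} (hΩ : MeasurableSet Ω) (hA : A ⊆ Ω)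
    (u : Space n → ℝ) : J0 A u ≤ J0 Ω u := by
  refine iSup₂_le fun φ hφ => ?_
  have hφ0 : ∀ x ∉ A, x ∉ tsupport φ := fun x hx h => hx (hφ.1.2.2 h)
  refine le_iSup₂_of_le φ ⟨⟨hφ.1.1, hφ.1.2.1, hφ.1.2.2.trans hA⟩, fun x hx => ?_⟩ ?_
  · by_cases hxA : x ∈ A
    · exact hφ.2 x hxA
    · simp [image_eq_zero_of_notMem_tsupport (hφ0 x hxA)]
  · rw [EReal.coe_le_coe_iff]
    refine (setIntegral_eq_of_subset_of_forall_sdiff_eq_zero hΩ hA fun x hx => ?_).ge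
    simp [divergence_eq_zero_of_notMem_tsupport (hφ0 x hx.2)]

theorem integrableOn_of_L2 {n : ℕ} {Ω : Set (Space n)} (hb : Bornology.IsBounded Ω) (u : L2 Ω) :
    IntegrableOn u Ω volume := by
  have : IsFiniteMeasure (volume.restrict Ω) := ⟨by simpa using hb.measure_lt_top⟩
  exact (Lp.memLp u).integrable (by norm_num)

/-- Coercivity: a Poincaré inequality modulo constants, together with `T χ_Ω ≠ 0`, bounds the
sublevel sets in `L²`. -/
theorem isBounded_sublevel_F {n : ℕ} {Ω : Set (Space n)} (ho : IsOpen Ω)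
    (hb : Bornology.IsBounded Ω) {Y : Type*} [NormedAddCommGroup Y]
    [NormedSpace ℝ Y] {T : L2 Ω →L[ℝ] Y} (hT : T (chi ho hb) ≠ 0) (v : Y) {α₁ α₂ : ℝ}
    (hα₁ : 0 < α₁) (hα₂ : 0 < α₂)
    {θ : Space n → ℝ} {c : ℝ} (hc : 0 < c) (hθc : ∀ x ∈ Ω, c ≤ θ x)
    {C : ℝ} (hC : ∀ (u : L2 Ω) (J : ℝ), J0 Ω u ≤ J → ∃ m : ℝ, ‖u - m • chi ho hb‖ ≤ C * J)
    (M : ℝ) : Bornology.IsBounded {u | F Ω T v α₁ α₂ θ u ≤ M} := by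
  set K := C * (M / (α₂ * c)) with hK
  set t := ‖T (chi ho hb)‖ with ht
  have ht0 : 0 < t := norm_pos_iff.2 hT
  refine isBounded_iff_forall_norm_le.2
    ⟨K + (‖T‖ * K + √M + ‖v‖) / t * ‖chi ho hb‖, fun u hu => ?_⟩
  obtain ⟨m, hm⟩ := hC u _ (J0_le_of_F_le hα₁ hα₂ hc hθc hu)
  rw [← hK] at hm
  have hTu : ‖T u - v‖ ≤ √M := by
    refine Real.le_sqrt_of_sq_le ?_
    have h := (F_le_coe_iff hα₂).1 hu 0 (zero_mem_weightedFields Ω θ)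
    have : 0 ≤ ∫ x in Ω, (√(1 - θ x) * u x) ^ 2 := integral_nonneg fun x => sq_nonneg _
    have h0 : ∫ x in Ω, -(u x) * divergence (fun y => θ y • (0 : Space n → Space n) y) x = 0 := by
      simp [divergence]
    rw [h0] at h
    nlinarith [mul_nonneg hα₁.le this]
  have hmt : |m| * t ≤ ‖T‖ * K + √M + ‖v‖ := by
    have e : m • T (chi ho hb) = -(T (u - m • chi ho hb)) + (T u - v) + v := by
      rw [map_sub, map_smul]; abel
    have h1 : ‖m • T (chi ho hb)‖ ≤ ‖T (u - m • chi ho hb)‖ + ‖T u - v‖ + ‖v‖ := by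
      rw [e]
      refine (norm_add_le _ _).trans ?_
      gcongr
      refine (norm_add_le _ _).trans ?_
      rw [norm_neg]
    rw [norm_smul, Real.norm_eq_abs] at h1
    have h2 := (T.le_opNorm (u - m • chi ho hb)).trans
      (mul_le_mul_of_nonneg_left hm (norm_nonneg T))
    linarith
  calc ‖u‖ = ‖(u - m • chi ho hb) + m • chi ho hb‖ := by rw [sub_add_cancel]
    _ ≤ ‖u - m • chi ho hb‖ + |m| * ‖chi ho hb‖ := by
        refine (norm_add_le _ _).trans ?_
        rw [norm_smul, Real.norm_eq_abs]
    _ ≤ _ := by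
        gcongr
        rwa [le_div_iff₀ ht0]

/-- Two minimizers agree where `θ < 1`, and have the same image under `T` when `Y` is strictly
convex: otherwise their midpoint would have a smaller value. -/
theorem minimizers_agree {n : ℕ} {Ω : Set (Space n)} (hΩ : MeasurableSet Ω) {Y : Type*}
    [NormedAddCommGroup Y] [NormedSpace ℝ Y] [StrictConvexSpace ℝ Y] {T : L2 Ω →L[ℝ] Y} {v : Y}
    {α₁ α₂ : ℝ} (hα₁ : 0 < α₁) (hα₂ : 0 < α₂) {θ : Space n → ℝ}
    (hθm : AEMeasurable θ (volume.restrict Ω)) (hθ : ∀ x ∈ Ω, θ x ∈ Set.Icc (0 : ℝ) 1)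
    {u w : L2 Ω} (hu : ∀ z, F Ω T v α₁ α₂ θ u ≤ F Ω T v α₁ α₂ θ z)
    (hw : ∀ z, F Ω T v α₁ α₂ θ w ≤ F Ω T v α₁ α₂ θ z) :
    T u = T w ∧ ∀ᵐ x ∂volume, x ∈ Ω \ regionOne Ω θ → (u - w : L2 Ω) x = 0 := by
  obtain ⟨S, hSae, hS⟩ := exists_clm_mul_sqrt hΩ hθm hθ
  obtain ⟨r, hr⟩ : ∃ r : ℝ, (r : EReal) = F Ω T v α₁ α₂ θ u :=
    ⟨_, EReal.coe_toReal ((hu 0).trans_lt (F_zero_lt_top hΩ T v α₁ hα₂ hθm hθ)).ne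
      (EReal.bot_lt_zero.trans_le (F_nonneg T v hα₁ hα₂ θ u)).ne'⟩
  have hur := (F_le_coe_iff hα₂).1 hr.ge
  have hwr := (F_le_coe_iff hα₂).1 ((hw u).trans hr.ge)
  set p := T u - v
  set q := T w - v
  -- `g` is the amount by which the value at the midpoint falls below the minimal value `r`
  set g := (‖p‖ ^ 2 + ‖q‖ ^ 2) / 2 - ‖(1 / 2 : ℝ) • (p + q)‖ ^ 2 + α₁ * (‖S (u - w)‖ ^ 2 / 4)
    with hg
  have key : F Ω T v α₁ α₂ θ ((1 / 2 : ℝ) • (u + w)) ≤ ((r - g : ℝ) : EReal) := by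
    refine (F_le_coe_iff hα₂).2 fun ν hν => ?_
    obtain ⟨ℓ, hℓ⟩ := exists_clm_eq_integral_divergence (Ω := Ω) hν.1
    have h1 := hur ν hν
    have h2 := hwr ν hν
    rw [← hℓ, hS] at h1 h2 ⊢
    have e1 : T ((1 / 2 : ℝ) • (u + w)) - v = (1 / 2 : ℝ) • (p + q) := by
      have : v = (1 / 2 : ℝ) • (v + v) := by rw [← two_smul ℝ v, smul_smul]; norm_num
      simp only [map_smul, map_add]
      nth_rw 1 [this]
      rw [← smul_sub]
      congr 1
      simp only [p, q]
      abel
    have e2 := parallelogram_law_with_norm ℝ (S u) (S w)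
    have e3 : ‖S ((1 / 2 : ℝ) • (u + w))‖ ^ 2 = (‖S u‖ ^ 2 + ‖S w‖ ^ 2) / 2
        - ‖S (u - w)‖ ^ 2 / 4 := by
      rw [map_smul, map_add, map_sub, norm_smul, Real.norm_of_nonneg (by norm_num), mul_pow]
      linarith
    rw [e1, e3, map_smul, map_add, smul_eq_mul]
    have : g = (‖p‖ ^ 2 + ‖q‖ ^ 2) / 2 - ‖(1 / 2 : ℝ) • (p + q)‖ ^ 2
      + α₁ * (‖S (u - w)‖ ^ 2 / 4) := hg
    linarith
  have hg0 : g ≤ 0 := by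
    have := (hr.le.trans (hu _)).trans key
    rw [EReal.coe_le_coe_iff] at this
    linarith
  have hn : ‖(1 / 2 : ℝ) • (p + q)‖ = ‖p + q‖ / 2 := by
    rw [norm_smul, Real.norm_of_nonneg (by norm_num)]; ring
  rw [hn] at hg
  have hpq := norm_add_le p q
  have hSn : 0 ≤ α₁ * (‖S (u - w)‖ ^ 2 / 4) := by positivity
  have hsq : ‖p + q‖ ^ 2 ≤ (‖p‖ + ‖q‖) ^ 2 := by gcongr
  have hd : (‖p‖ - ‖q‖) ^ 2 ≤ 0 := by nlinarith
  have hnorm : ‖p‖ = ‖q‖ := by nlinarith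
  have hS0 : S (u - w) = 0 := by
    have : α₁ * (‖S (u - w)‖ ^ 2 / 4) ≤ 0 := by nlinarith
    have h0 : ‖S (u - w)‖ ^ 2 ≤ 0 := by
      by_contra! h
      nlinarith [mul_pos hα₁ h]
    rw [← norm_eq_zero]
    exact pow_eq_zero_iff (two_ne_zero) |>.1 (le_antisymm h0 (sq_nonneg _))
  have hadd : ‖p + q‖ = ‖p‖ + ‖q‖ := by
    refine le_antisymm hpq (le_of_sq_le_sq ?_ (norm_nonneg _))
    nlinarith
  refine ⟨?_, ?_⟩
  · have := eq_of_norm_eq_of_norm_add_eq hnorm hadd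
    simpa [p, q] using this
  · have h1 := hSae (u - w)
    rw [hS0] at h1
    have h2 : ∀ᵐ x ∂volume.restrict Ω, √(1 - θ x) * (u - w : L2 Ω) x = 0 := by
      filter_upwards [h1, Lp.coeFn_zero ℝ 2 (volume.restrict Ω)] with x hx hx0
      rw [← hx, hx0]; rfl
    filter_upwards [(ae_restrict_iff' hΩ).1 h2] with x hx hxΩ
    refine (mul_eq_zero.1 (hx hxΩ.1)).resolve_left ?_
    have hlt : θ x < 1 := lt_of_le_of_ne (hθ x hxΩ.1).2 fun h => hxΩ.2 ⟨hxΩ.1, h⟩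
    exact (Real.sqrt_pos.2 (by linarith)).ne'

/-! ### Variation along lines -/

/-- The variation of `w` along the part in `D` of the line through `x` with direction `e`,
parametrized by `s ↦ x + s e`. -/
noncomputable def lineVariation {n : ℕ} (D : Set (Space n)) (w : Space n → ℝ)
    (e x : Space n) : ℝ≥0∞ :=
  ∫⁻ s : ℝ, D.indicator (fun y => ‖fderiv ℝ w y e‖ₑ) (x + s • e)

theorem lineVariation_add_smul {n : ℕ} (D : Set (Space n)) (w : Space n → ℝ) (e x : Space n)
    (t : ℝ) : lineVariation D w e (x + t • e) = lineVariation D w e x := by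
  unfold lineVariation
  rw [← lintegral_add_left_eq_self (fun s : ℝ => D.indicator _ (x + s • e)) t]
  simp only [add_smul, add_assoc]

theorem enorm_sub_le_lineVariation {n : ℕ} {D : Set (Space n)} (hD : Convex ℝ D)
    {w : Space n → ℝ} (hw : ContDiff ℝ 1 w) {e x : Space n} {t : ℝ} (hx : x ∈ D)
    (hxt : x + t • e ∈ D) : ‖w (x + t • e) - w x‖ₑ ≤ lineVariation D w e x := by
  have hline : ∀ s : ℝ, HasDerivAt (fun s : ℝ => x + s • e) e s := fun s => by
    simpa using ((hasDerivAt_id s).smul_const e).const_add x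
  have hderiv : ∀ s : ℝ, HasDerivAt (fun s : ℝ => w (x + s • e)) (fderiv ℝ w (x + s • e) e) s :=
    fun s => ((hw.differentiable one_ne_zero _).hasFDerivAt).comp_hasDerivAt s (hline s)
  have hcont : Continuous fun s : ℝ => fderiv ℝ w (x + s • e) e :=
    ((hw.continuous_fderiv one_ne_zero).comp (by fun_prop)).clm_apply continuous_const
  have hftc := intervalIntegral.integral_eq_sub_of_hasDerivAt
    (fun s _ => hderiv s) (hcont.intervalIntegrable 0 t)
  simp only [zero_smul, add_zero] at hftc
  rw [← hftc, ← enorm_norm, intervalIntegral.norm_intervalIntegral_eq, enorm_norm]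
  refine (enorm_integral_le_lintegral_enorm _).trans ?_
  rw [← lintegral_indicator measurableSet_uIoc]
  refine lintegral_mono fun s => ?_
  by_cases hs : s ∈ Set.uIoc 0 t
  · have hmem : x + s • e ∈ D := by
      have hc : Convex ℝ ((fun s : ℝ => x + s • e) ⁻¹' D) := by
        intro a ha b hb p q hp hq hpq
        have h := hD ha hb hp hq hpq
        have e1 : p • (x + a • e) + q • (x + b • e) = x + (p • a + q • b) • e := by
          have : x = (p + q) • x := by rw [hpq, one_smul]
          nth_rw 3 [this]
          simp only [smul_add, add_smul, smul_smul, smul_eq_mul]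
          abel
        rwa [e1] at h
      exact hc.ordConnected.uIcc_subset (by simpa using hx) hxt (Set.uIoc_subset_uIcc hs)
    simp [hs, hmem]
  · simp [hs]

/-- Integration in linear coordinates: a linear isomorphism onto `ℝⁿ` changes Lebesgue measure by
a positive constant. -/
theorem exists_lintegral_eq_mul_lintegral_comp {n : ℕ} {E : Type*} [NormedAddCommGroup E]
    [NormedSpace ℝ E] [MeasureSpace E] [BorelSpace E]
    [(volume : Measure E).IsAddHaarMeasure] (Φ : E ≃L[ℝ] Space n) :
    ∃ κ : ℝ≥0∞, κ ≠ 0 ∧ κ ≠ ⊤ ∧ ∀ f : Space n → ℝ≥0∞, Measurable f →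
      ∫⁻ x, f x = κ * ∫⁻ y : E, f (Φ y) := by
  have : (Measure.map Φ (volume : Measure E)).IsAddHaarMeasure := Φ.isAddHaarMeasure_map volume
  have h := Measure.isAddLeftInvariant_eq_smul (volume : Measure (Space n))
    (Measure.map Φ (volume : Measure E))
  refine ⟨(Measure.addHaarScalarFactor (volume : Measure (Space n))
    (Measure.map Φ (volume : Measure E)) : ℝ≥0∞), ?_, ENNReal.coe_ne_top, fun f hf => ?_⟩
  · rw [ENNReal.coe_ne_zero]
    exact (Measure.addHaarScalarFactor_pos_of_isAddHaarMeasure _ _).ne'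
  · conv_lhs => rw [h]
    rw [lintegral_smul_measure, lintegral_map hf Φ.continuous.measurable]
    rfl

theorem measurable_indicator_enorm_fderiv {n : ℕ} {D : Set (Space n)} (hD : MeasurableSet D)
    {w : Space n → ℝ} (hw : ContDiff ℝ 1 w) (e : Space n) :
    Measurable (D.indicator fun y => ‖fderiv ℝ w y e‖ₑ) := by
  have : Continuous fun y => ‖fderiv ℝ w y e‖ₑ :=
    ((hw.continuous_fderiv one_ne_zero).clm_apply continuous_const).enorm
  exact this.measurable.indicator hD

theorem measurable_lineVariation {n : ℕ} {D : Set (Space n)} (hD : MeasurableSet D)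
    {w : Space n → ℝ} (hw : ContDiff ℝ 1 w) (e : Space n) :
    Measurable (lineVariation D w e) := by
  refine Measurable.lintegral_prod_right'
    (f := fun p : Space n × ℝ => D.indicator (fun y => ‖fderiv ℝ w y e‖ₑ) (p.1 + p.2 • e)) ?_
  exact (measurable_indicator_enorm_fderiv hD hw e).comp (by fun_prop)

/-- Two independent vectors of the plane are coordinate axes with coordinate functionals `A` and
`B`, and integration in these coordinates is given by iterated integrals up to a constant. -/
theorem exists_plane_coordinates {e e' : Space 2}
    (hee : ∀ a b : ℝ, a • e + b • e' = 0 → a = 0 ∧ b = 0) :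
    ∃ (A B : Space 2 →L[ℝ] ℝ) (κ : ℝ≥0∞),
      (∀ a b : ℝ, A (a • e + b • e') = a ∧ B (a • e + b • e') = b) ∧ κ ≠ 0 ∧ κ ≠ ⊤ ∧
      ∀ f : Space 2 → ℝ≥0∞, Measurable f →
        ∫⁻ x, f x = κ * ∫⁻ b : ℝ, ∫⁻ a : ℝ, f (a • e + b • e') := by
  set Ψ : ℝ × ℝ →ₗ[ℝ] Space 2 :=
    (LinearMap.toSpanSingleton ℝ _ e).coprod (LinearMap.toSpanSingleton ℝ _ e') with hΨ
  have hΨa : ∀ p : ℝ × ℝ, Ψ p = p.1 • e + p.2 • e' := fun p => by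
    simp [hΨ, LinearMap.toSpanSingleton_apply]
  have hinj : Function.Injective Ψ := by
    rw [← LinearMap.ker_eq_bot, LinearMap.ker_eq_bot']
    intro p hp
    rw [hΨa] at hp
    obtain ⟨h1, h2⟩ := hee _ _ hp
    exact Prod.ext h1 h2
  set Φ : (ℝ × ℝ) ≃L[ℝ] Space 2 :=
    (LinearEquiv.ofInjectiveOfFinrankEq Ψ hinj (by simp)).toContinuousLinearEquiv with hΦ
  have hΦa : ∀ p : ℝ × ℝ, Φ p = p.1 • e + p.2 • e' := fun p => hΨa p
  obtain ⟨κ, h0, h1, h2⟩ := exists_lintegral_eq_mul_lintegral_comp Φ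
  refine ⟨(ContinuousLinearMap.fst ℝ ℝ ℝ).comp (Φ.symm : Space 2 →L[ℝ] ℝ × ℝ),
    (ContinuousLinearMap.snd ℝ ℝ ℝ).comp (Φ.symm : Space 2 →L[ℝ] ℝ × ℝ), κ,
    fun a b => ?_, h0, h1, fun f hf => ?_⟩
  · have : Φ.symm (a • e + b • e') = (a, b) := by
      rw [Φ.symm_apply_eq, hΦa]
    simp [this]
  · have hm : Measurable fun p => f (Φ p) := hf.comp Φ.continuous.measurable
    rw [h2 f hf, Measure.volume_eq_prod, lintegral_prod_symm _ hm.aemeasurable]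
    simp only [hΦa]

/-- The mass of a directional derivative on `D` is the integral over all parallel lines of the
line variations. -/
theorem exists_lintegral_lineVariation_le {e e' : Space 2}
    (hee : ∀ a b : ℝ, a • e + b • e' = 0 → a = 0 ∧ b = 0) :
    ∃ k : ℝ≥0∞, k ≠ ⊤ ∧ ∀ (D : Set (Space 2)) (w : Space 2 → ℝ) (V : ℝ≥0∞), MeasurableSet D →
      ContDiff ℝ 1 w → (∫⁻ x in D, ‖fderiv ℝ w x e‖ₑ ≤ ‖e‖ₑ * V) →
      ∫⁻ b : ℝ, lineVariation D w e (b • e') ≤ k * V := by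
  obtain ⟨A, B, κ, -, h0, h1, h2⟩ := exists_plane_coordinates hee
  refine ⟨κ⁻¹ * ‖e‖ₑ, ENNReal.mul_ne_top (by simpa using h0) enorm_ne_top,
    fun D w V hD hw hV => ?_⟩
  have h := h2 _ (measurable_indicator_enorm_fderiv hD hw e)
  rw [lintegral_indicator hD] at h
  have h3 : ∫⁻ b : ℝ, lineVariation D w e (b • e') = κ⁻¹ * ∫⁻ x in D, ‖fderiv ℝ w x e‖ₑ := by
    rw [h, ← mul_assoc, ENNReal.inv_mul_cancel h0 h1, one_mul]
    unfold lineVariation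
    simp only [add_comm]
  rw [h3, mul_assoc]
  gcongr

/-- Among the lines with direction `e` meeting a given transversal segment, at least one carries
no more than a fixed multiple of the total variation. -/
theorem exists_line_lineVariation_le {e e' : Space 2}
    (hee : ∀ a b : ℝ, a • e + b • e' = 0 → a = 0 ∧ b = 0) {α β : ℝ} (hαβ : α < β) :
    ∃ k : ℝ≥0∞, k ≠ ⊤ ∧ ∀ (D : Set (Space 2)) (w : Space 2 → ℝ) (V : ℝ≥0∞), MeasurableSet D →
      ContDiff ℝ 1 w → (∫⁻ x in D, ‖fderiv ℝ w x e‖ₑ ≤ ‖e‖ₑ * V) →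
      ∃ b ∈ Set.Ioo α β, lineVariation D w e (b • e') ≤ k * V := by
  obtain ⟨k, hk, h⟩ := exists_lintegral_lineVariation_le hee
  have hI0 : volume (Set.Ioo α β) ≠ 0 := by simp [hαβ]
  have hIt : volume (Set.Ioo α β) ≠ ⊤ := by simp
  refine ⟨k / volume (Set.Ioo α β), ENNReal.div_ne_top hk hI0, fun D w V hD hw hV => ?_⟩
  have hm : Measurable fun b : ℝ => lineVariation D w e (b • e') :=
    (measurable_lineVariation hD hw e).comp (by fun_prop)
  obtain ⟨b, hb, hle⟩ := exists_le_setLAverage hI0 hIt hm.aemeasurable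
  refine ⟨b, hb, hle.trans ?_⟩
  rw [setLAverage_eq, ENNReal.div_eq_inv_mul, ENNReal.div_eq_inv_mul, mul_assoc]
  gcongr
  exact (setLIntegral_le_lintegral _ _).trans (h D w V hD hw hV)

/-- In coordinates along `e` and `e'` the two line variations depend on different variables, so
the integral of their product factorizes. This is where the exponent `2 = n / (n - 1)` of the
plane comes from. -/
theorem exists_lintegral_mul_lineVariation_le {e e' : Space 2}
    (hee : ∀ a b : ℝ, a • e + b • e' = 0 → a = 0 ∧ b = 0) (R : ℝ) {k : ℝ≥0∞} (hk : k ≠ ⊤) :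
    ∃ C : ℝ≥0∞, C ≠ ⊤ ∧ ∀ (D : Set (Space 2)) (w : Space 2 → ℝ) (V : ℝ≥0∞), MeasurableSet D →
      D ⊆ Metric.closedBall 0 R → ContDiff ℝ 1 w →
      (∀ e, ∫⁻ x in D, ‖fderiv ℝ w x e‖ₑ ≤ ‖e‖ₑ * V) →
      ∫⁻ x in D, (lineVariation D w e x + k * V) * (lineVariation D w e' x + k * V)
        ≤ C * V ^ 2 := by
  obtain ⟨A, B, κ, hAB, h0, h1, h2⟩ := exists_plane_coordinates hee
  obtain ⟨k₁, hk₁, hf⟩ := exists_lintegral_lineVariation_le hee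
  obtain ⟨k₂, hk₂, hg⟩ := exists_lintegral_lineVariation_le (e := e') (e' := e)
    fun a b h => (hee b a (by rwa [add_comm])).symm
  set I := Set.Icc (-(‖A‖ * R)) (‖A‖ * R)
  set I' := Set.Icc (-(‖B‖ * R)) (‖B‖ * R)
  have hIm : MeasurableSet I := measurableSet_Icc
  have hIm' : MeasurableSet I' := measurableSet_Icc
  have hI : volume I ≠ ⊤ := by simp [I]
  have hI' : volume I' ≠ ⊤ := by simp [I']
  refine ⟨κ * ((k₁ + k * volume I') * (k₂ + k * volume I)), by finiteness,
    fun D w V hD hDR hw hV => ?_⟩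
  set f : ℝ → ℝ≥0∞ := fun b => lineVariation D w e (b • e') + k * V with hfdef
  set g : ℝ → ℝ≥0∞ := fun a => lineVariation D w e' (a • e) + k * V with hgdef
  have hmM := measurable_lineVariation hD hw e
  have hmM' := measurable_lineVariation hD hw e'
  have hmf : Measurable f := (hmM.comp (by fun_prop)).add_const _
  have hmg : Measurable g := (hmM'.comp (by fun_prop)).add_const _
  have hprod : Measurable fun x =>
      (lineVariation D w e x + k * V) * (lineVariation D w e' x + k * V) :=
    (hmM.add_const _).mul (hmM'.add_const _)
  have hpt : ∀ a b : ℝ, D.indicator (fun x =>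
      (lineVariation D w e x + k * V) * (lineVariation D w e' x + k * V)) (a • e + b • e')
      ≤ I'.indicator f b * I.indicator g a := by
    intro a b
    by_cases hx : a • e + b • e' ∈ D
    · have hn : ‖a • e + b • e'‖ ≤ R := by simpa using hDR hx
      have ha : a ∈ I := by
        have := (A.le_opNorm (a • e + b • e')).trans
          (mul_le_mul_of_nonneg_left hn (norm_nonneg A))
        rw [(hAB a b).1] at this
        exact abs_le.1 this
      have hb : b ∈ I' := by
        have := (B.le_opNorm (a • e + b • e')).trans
          (mul_le_mul_of_nonneg_left hn (norm_nonneg B))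
        rw [(hAB a b).2] at this
        exact abs_le.1 this
      rw [Set.indicator_of_mem hx, Set.indicator_of_mem ha, Set.indicator_of_mem hb,
        lineVariation_add_smul, add_comm (a • e), lineVariation_add_smul]
    · simp [hx]
  have hV2 : ∀ (c : ℝ≥0∞) (J : Set ℝ) (φ : ℝ → ℝ≥0∞), MeasurableSet J →
      ∫⁻ s, φ s ≤ c * V → ∫⁻ s, J.indicator (fun s => φ s + k * V) s
        ≤ (c + k * volume J) * V := by
    intro c J φ hJ hφ
    rw [lintegral_indicator hJ, lintegral_add_right _ measurable_const, setLIntegral_const,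
      add_mul, mul_right_comm]
    gcongr
    exact (setLIntegral_le_lintegral _ _).trans hφ
  rw [← lintegral_indicator hD, h2 _ (hprod.indicator hD)]
  calc κ * ∫⁻ b : ℝ, ∫⁻ a : ℝ, _
      ≤ κ * ∫⁻ b : ℝ, ∫⁻ a : ℝ, I'.indicator f b * I.indicator g a := by
        gcongr with b a
        exact hpt a b
    _ = κ * ((∫⁻ b, I'.indicator f b) * ∫⁻ a, I.indicator g a) := by
        congr 1
        rw [← lintegral_mul_const _ (hmf.indicator hIm')]
        congr 1 with b
        rw [lintegral_const_mul _ (hmg.indicator hIm)]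
    _ ≤ κ * (((k₁ + k * volume I') * V) * ((k₂ + k * volume I) * V)) := by
        gcongr
        · exact hV2 k₁ I' _ hIm' (hf D w V hD hw (hV e))
        · exact hV2 k₂ I _ hIm (hg D w V hD hw (hV e'))
    _ = _ := by ring

/-! ### The Poincaré–Sobolev inequality for smooth functions -/

/-- From `x` one moves in direction `-e` to a vertical line, along it to a horizontal line, and
along that one to the reference point; the three legs cost one line variation each. -/
theorem enorm_sub_le_of_cross {D : Set (Space 2)} (hD : Convex ℝ D)
    {w : Space 2 → ℝ} (hw : ContDiff ℝ 1 w) {e x : Space 2} {a b c : ℝ} (hx : x ∈ D)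
    (hxe : x - e ∈ D) (ha : a ∈ Set.uIcc (x 0) ((x - e) 0)) (hm : !₂[a, b] ∈ D)
    (hc : !₂[c, b] ∈ D) :
    ‖w x - w !₂[c, b]‖ₑ ≤ lineVariation D w e x +
      (lineVariation D w (EuclideanSpace.single 1 1) (a • EuclideanSpace.single 0 (1 : ℝ)) +
        lineVariation D w (EuclideanSpace.single 0 1) (b • EuclideanSpace.single 1 (1 : ℝ))) := by
  -- the point where the segment from `x` to `x - e` meets the vertical line at abscissa `a`
  obtain ⟨t, ht, hta⟩ : ∃ t ∈ Set.Icc (0 : ℝ) 1, (x - t • e) 0 = a := by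
    have hcont : ContinuousOn (fun t : ℝ => (x - t • e) 0) (Set.uIcc 0 1) := by
      refine Continuous.continuousOn ?_
      simp only [PiLp.sub_apply, PiLp.smul_apply]
      fun_prop
    have := intermediate_value_uIcc hcont (by simpa using ha)
    simpa [Set.uIcc_of_le] using this
  set q := x - t • e with hq
  have hqD : q ∈ D := by
    have h := hD hx hxe (sub_nonneg.2 ht.2) ht.1 (by ring)
    have e1 : (1 - t) • x + t • (x - e) = q := by
      simp only [hq, sub_smul, one_smul, smul_sub]; abel
    rwa [e1] at h
  have h1 : ‖w x - w q‖ₑ ≤ lineVariation D w e x := by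
    have e1 : x = q + t • e := by simp [hq]
    have h := enorm_sub_le_lineVariation hD hw (x := q) (e := e) (t := t) hqD (by rwa [← e1])
    rwa [← lineVariation_add_smul D w e q t, ← e1] at h
  have h2 : ‖w q - w !₂[a, b]‖ₑ ≤ lineVariation D w (EuclideanSpace.single 1 1)
      (a • EuclideanSpace.single 0 (1 : ℝ)) := by
    have e1 : q = !₂[a, b] + (q 1 - b) • EuclideanSpace.single 1 (1 : ℝ) := by
      ext i; fin_cases i
      · simp [hta]
      · simp
    have e2 : !₂[a, b] = a • EuclideanSpace.single 0 (1 : ℝ) +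
        b • EuclideanSpace.single 1 (1 : ℝ) := by
      ext i; fin_cases i <;> simp
    have h := enorm_sub_le_lineVariation hD hw (x := !₂[a, b]) (t := q 1 - b)
      (e := EuclideanSpace.single 1 (1 : ℝ)) hm (by rwa [← e1])
    rw [← e1] at h
    rw [← lineVariation_add_smul D w _ (a • EuclideanSpace.single 0 (1 : ℝ)) b, ← e2]
    exact h
  have h3 : ‖w !₂[a, b] - w !₂[c, b]‖ₑ ≤ lineVariation D w (EuclideanSpace.single 0 1)
      (b • EuclideanSpace.single 1 (1 : ℝ)) := by
    have e1 : !₂[a, b] = !₂[c, b] + (a - c) • EuclideanSpace.single 0 (1 : ℝ) := by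
      ext i; fin_cases i <;> simp
    have e2 : !₂[c, b] = b • EuclideanSpace.single 1 (1 : ℝ) +
        c • EuclideanSpace.single 0 (1 : ℝ) := by
      ext i; fin_cases i <;> simp
    have h := enorm_sub_le_lineVariation hD hw (x := !₂[c, b]) (t := a - c)
      (e := EuclideanSpace.single 0 (1 : ℝ)) hc (by rwa [← e1])
    rw [← e1] at h
    rw [← lineVariation_add_smul D w _ (b • EuclideanSpace.single 1 (1 : ℝ)) c, ← e2]
    exact h
  have e : w x - w !₂[c, b] = (w x - w q) + ((w q - w !₂[a, b]) + (w !₂[a, b] - w !₂[c, b])) := by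
    ring
  rw [e]
  exact (enorm_add_le _ _).trans (add_le_add h1 ((enorm_add_le _ _).trans (add_le_add h2 h3)))

theorem norm_plane_le (a b : ℝ) : ‖(!₂[a, b] : Space 2)‖ ≤ |a| + |b| := by
  rw [EuclideanSpace.norm_eq, Real.sqrt_le_iff]
  refine ⟨by positivity, ?_⟩
  simp only [Fin.sum_univ_two, Real.norm_eq_abs]
  simp
  nlinarith [abs_nonneg a, abs_nonneg b, sq_abs a, sq_abs b]

/-- The local estimate near a point `p` lying on the side `σ` of the vertical line through `o`:
all nearby points see a vertical line on the other side in two independent directions. -/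
theorem exists_lintegral_sq_ball_le (o p : Space 2) {δ R σ : ℝ} (hδ : 0 < δ)
    (hσ : σ = 1 ∨ σ = -1) (hp : 0 ≤ σ * (p 0 - o 0)) {k : ℝ≥0∞} (hk : k ≠ ⊤) :
    ∃ C : ℝ≥0∞, C ≠ ⊤ ∧ ∀ (D : Set (Space 2)) (w : Space 2 → ℝ) (V : ℝ≥0∞), MeasurableSet D →
      Convex ℝ D → Metric.ball o (6 * δ) ⊆ D → D ⊆ Metric.closedBall 0 R → ContDiff ℝ 1 w →
      (∀ e, ∫⁻ x in D, ‖fderiv ℝ w x e‖ₑ ≤ ‖e‖ₑ * V) →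
      ∀ a b : ℝ, σ * (o 0 - a) ∈ Set.Icc δ (2 * δ) → |b - o 1| ≤ δ →
      lineVariation D w (EuclideanSpace.single 1 1) (a • EuclideanSpace.single 0 (1 : ℝ)) +
        lineVariation D w (EuclideanSpace.single 0 1) (b • EuclideanSpace.single 1 (1 : ℝ))
          ≤ k * V →
      ∫⁻ x in D ∩ Metric.ball p δ, ‖w x - w !₂[o 0, b]‖ₑ ^ 2 ≤ C * V ^ 2 := by
  -- `z` and `z'` lie at different heights beyond the strip that contains the vertical line, so
  -- that `p - z` and `p - z'` are independent and translates of the segments from `p` to them by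
  -- less than `δ` cross the line
  set z : Space 2 := !₂[o 0 - 3 * σ * δ, o 1] with hz
  set z' : Space 2 := !₂[o 0 - 3 * σ * δ, o 1 + δ] with hz'
  have hσ2 : σ * σ = 1 := by rcases hσ with rfl | rfl <;> norm_num
  have hσa : |σ| = 1 := by rcases hσ with rfl | rfl <;> norm_num
  have hee : ∀ a b : ℝ, a • (p - z) + b • (p - z') = 0 → a = 0 ∧ b = 0 := by
    intro a b h
    have h0 : a * (p 0 - (o 0 - 3 * σ * δ)) + b * (p 0 - (o 0 - 3 * σ * δ)) = 0 := by
      simpa [hz, hz'] using congrArg (fun y : Space 2 => y 0) h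
    have h1 : a * (p 1 - o 1) + b * (p 1 - (o 1 + δ)) = 0 := by
      simpa [hz, hz'] using congrArg (fun y : Space 2 => y 1) h
    have hne : p 0 - (o 0 - 3 * σ * δ) ≠ 0 := by
      intro h
      have : σ * (p 0 - o 0) + 3 * (σ * σ) * δ = 0 := by linear_combination σ * h
      rw [hσ2] at this
      linarith
    have hab : a + b = 0 := by
      have : (a + b) * (p 0 - (o 0 - 3 * σ * δ)) = 0 := by linear_combination h0
      exact (mul_eq_zero.1 this).resolve_right hne
    have hbδ : b * δ = 0 := by linear_combination (p 1 - o 1) * hab - h1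
    have hb : b = 0 := (mul_eq_zero.1 hbδ).resolve_right hδ.ne'
    exact ⟨by linarith, hb⟩
  obtain ⟨C, hC, h⟩ := exists_lintegral_mul_lineVariation_le hee R hk
  refine ⟨C, hC, fun D w V hDm hD hoD hDR hw hV a b ha hb hab => ?_⟩
  refine le_trans ?_ (h D w V hDm hDR hw hV)
  refine le_trans ?_ (lintegral_mono_set (Set.inter_subset_left (t := Metric.ball p δ)))
  refine setLIntegral_mono' (hDm.inter Metric.isOpen_ball.measurableSet) ?_
  rintro x ⟨hxD, hxp⟩
  have hxp' : ‖x - p‖ < δ := by simpa [dist_eq_norm] using hxp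
  have hx0 : |x 0 - p 0| < δ :=
    lt_of_le_of_lt (by simpa using PiLp.norm_apply_le (x - p) 0) hxp'
  have hcoord : ∀ c d : ℝ, |c - o 0| + |d - o 1| < 6 * δ → !₂[c, d] ∈ D := by
    intro c d hcd
    refine hoD ?_
    rw [Metric.mem_ball, dist_eq_norm]
    have : (!₂[c, d] - o : Space 2) = !₂[c - o 0, d - o 1] := by
      ext i; fin_cases i <;> simp
    rw [this]
    exact (norm_plane_le _ _).trans_lt hcd
  have hza : |o 0 - 3 * σ * δ - o 0| = 3 * δ := by
    rw [show o 0 - 3 * σ * δ - o 0 = -(σ * (3 * δ)) by ring, abs_neg, abs_mul, hσa, one_mul,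
      abs_of_pos (by linarith)]
  have hzball : ∀ y : Space 2, ‖y - o‖ ≤ 4 * δ → x - (p - y) ∈ D := by
    intro y hy
    refine hoD ?_
    rw [Metric.mem_ball, dist_eq_norm]
    have : x - (p - y) - o = (x - p) + (y - o) := by abel
    rw [this]
    linarith [norm_add_le (x - p) (y - o)]
  have hzo : ∀ d : ℝ, |d - o 1| ≤ δ → ‖(!₂[o 0 - 3 * σ * δ, d] : Space 2) - o‖ ≤ 4 * δ := by
    intro d hd
    have : (!₂[o 0 - 3 * σ * δ, d] - o : Space 2) = !₂[o 0 - 3 * σ * δ - o 0, d - o 1] := by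
      ext i; fin_cases i <;> simp
    rw [this]
    refine (norm_plane_le _ _).trans ?_
    rw [hza]
    linarith
  have ha' : |a - o 0| ≤ 2 * δ := by
    rw [abs_sub_comm, ← one_mul |o 0 - a|, ← hσa, ← abs_mul, abs_of_nonneg (hδ.le.trans ha.1)]
    exact ha.2
  have hm := hcoord a b (by linarith)
  have hc := hcoord (o 0) b (by simp only [sub_self, abs_zero]; linarith)
  -- the vertical line separates `x` from both endpoints
  have hside : ∀ d : ℝ, a ∈ Set.uIcc (x 0)
      ((x - (p - (!₂[o 0 - 3 * σ * δ, d] : Space 2))) 0) := by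
    intro d
    have e1 : (x - (p - (!₂[o 0 - 3 * σ * δ, d] : Space 2))) 0
        = x 0 - p 0 + (o 0 - 3 * σ * δ) := by simp; ring
    rw [e1]
    obtain ⟨h1, h2⟩ := abs_lt.1 hx0
    rcases hσ with rfl | rfl
    · refine Set.mem_uIcc.2 (Or.inr ⟨?_, ?_⟩) <;> linarith [ha.1, ha.2]
    · refine Set.mem_uIcc.2 (Or.inl ⟨?_, ?_⟩) <;> linarith [ha.1, ha.2]
  rw [sq]
  refine mul_le_mul' ?_ ?_
  · exact (enorm_sub_le_of_cross hD hw hxD (hzball z (hzo _ (by simp [hδ.le])))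
      (hside _) hm hc).trans (add_le_add le_rfl hab)
  · exact (enorm_sub_le_of_cross hD hw hxD
      (hzball z' (hzo _ (by simp [abs_of_pos hδ]))) (hside _) hm hc).trans
      (add_le_add le_rfl hab)

/-- The Poincaré–Sobolev inequality for `C¹` functions on planar convex sets, with a constant that
depends only on an inner and an outer ball. -/
theorem exists_poincare_smooth_plane (o : Space 2) {r : ℝ} (hr : 0 < r) (R : ℝ) :
    ∃ C : ℝ≥0∞, C ≠ ⊤ ∧ ∀ (D : Set (Space 2)) (w : Space 2 → ℝ) (V : ℝ≥0∞), MeasurableSet D →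
      Convex ℝ D → Metric.ball o r ⊆ D → D ⊆ Metric.closedBall 0 R → ContDiff ℝ 1 w →
      (∀ e, ∫⁻ x in D, ‖fderiv ℝ w x e‖ₑ ≤ ‖e‖ₑ * V) →
      ∃ c : ℝ, ∫⁻ x in D, ‖w x - c‖ₑ ^ 2 ≤ C * V ^ 2 := by
  obtain ⟨δ, hδ, rfl⟩ : ∃ δ, 0 < δ ∧ r = 6 * δ := ⟨r / 6, by positivity, by ring⟩
  have h01 : ∀ a b : ℝ, a • EuclideanSpace.single (0 : Fin 2) (1 : ℝ) +
      b • EuclideanSpace.single (1 : Fin 2) (1 : ℝ) = 0 → a = 0 ∧ b = 0 := fun a b h =>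
    ⟨by simpa using congrArg (fun y : Space 2 => y 0) h,
      by simpa using congrArg (fun y : Space 2 => y 1) h⟩
  have h10 : ∀ a b : ℝ, a • EuclideanSpace.single (1 : Fin 2) (1 : ℝ) +
      b • EuclideanSpace.single (0 : Fin 2) (1 : ℝ) = 0 → a = 0 ∧ b = 0 := fun a b h =>
    (h01 b a (by rwa [add_comm])).symm
  -- two vertical lines, left and right of `o`, and a horizontal one near `o` carry little variation
  obtain ⟨k₁, hk₁, hline₁⟩ := exists_line_lineVariation_le h10
    (show o 0 - 2 * δ < o 0 - δ by linarith)
  obtain ⟨k₂, hk₂, hline₂⟩ := exists_line_lineVariation_le h10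
    (show o 0 + δ < o 0 + 2 * δ by linarith)
  obtain ⟨k₃, hk₃, hline₃⟩ := exists_line_lineVariation_le h01
    (show o 1 - δ < o 1 + δ by linarith)
  have hloc : ∀ p : Space 2, ∃ C : ℝ≥0∞, C ≠ ⊤ ∧ ∀ (D : Set (Space 2)) (w : Space 2 → ℝ)
      (V : ℝ≥0∞), MeasurableSet D →
      Convex ℝ D → Metric.ball o (6 * δ) ⊆ D → D ⊆ Metric.closedBall 0 R → ContDiff ℝ 1 w →
      (∀ e, ∫⁻ x in D, ‖fderiv ℝ w x e‖ₑ ≤ ‖e‖ₑ * V) →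
      ∀ a a' b : ℝ, a ∈ Set.Ioo (o 0 - 2 * δ) (o 0 - δ) →
      a' ∈ Set.Ioo (o 0 + δ) (o 0 + 2 * δ) → |b - o 1| ≤ δ →
      lineVariation D w (EuclideanSpace.single 1 1) (a • EuclideanSpace.single 0 (1 : ℝ))
        ≤ k₁ * V →
      lineVariation D w (EuclideanSpace.single 1 1) (a' • EuclideanSpace.single 0 (1 : ℝ))
        ≤ k₂ * V →
      lineVariation D w (EuclideanSpace.single 0 1) (b • EuclideanSpace.single 1 (1 : ℝ))
        ≤ k₃ * V →
      ∫⁻ x in D ∩ Metric.ball p δ, ‖w x - w !₂[o 0, b]‖ₑ ^ 2 ≤ C * V ^ 2 := by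
    intro p
    rcases le_total (o 0) (p 0) with hp | hp
    · obtain ⟨C, hC, h⟩ := exists_lintegral_sq_ball_le o p (R := R) hδ (Or.inl rfl)
        (by linarith) (show k₁ + k₃ ≠ ⊤ by finiteness)
      refine ⟨C, hC, fun D w V hDm hD hoD hDR hw hV a a' b ha ha' hb h1 h2 h3 => ?_⟩
      refine h D w V hDm hD hoD hDR hw hV a b ⟨?_, ?_⟩ hb ?_
      · linarith [ha.2]
      · linarith [ha.1]
      · rw [add_mul]; exact add_le_add h1 h3
    · obtain ⟨C, hC, h⟩ := exists_lintegral_sq_ball_le o p (R := R) hδ (Or.inr rfl)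
        (by linarith) (show k₂ + k₃ ≠ ⊤ by finiteness)
      refine ⟨C, hC, fun D w V hDm hD hoD hDR hw hV a a' b ha ha' hb h1 h2 h3 => ?_⟩
      refine h D w V hDm hD hoD hDR hw hV a' b ⟨?_, ?_⟩ hb ?_
      · linarith [ha'.1]
      · linarith [ha'.2]
      · rw [add_mul]; exact add_le_add h2 h3
  choose C hC hloc using hloc
  obtain ⟨t, -, htf, ht⟩ := (isCompact_closedBall (0 : Space 2) R).finite_cover_balls hδ
  refine ⟨∑ p ∈ htf.toFinset, C p, by simp [hC], fun D w V hDm hD hoD hDR hw hV => ?_⟩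
  obtain ⟨a, ha, h1⟩ := hline₁ D w V hDm hw (hV _)
  obtain ⟨a', ha', h2⟩ := hline₂ D w V hDm hw (hV _)
  obtain ⟨b, hb, h3⟩ := hline₃ D w V hDm hw (hV _)
  have hb' : |b - o 1| ≤ δ := abs_le.2 ⟨by linarith [hb.1], by linarith [hb.2]⟩
  refine ⟨w !₂[o 0, b], ?_⟩
  have hcover : D ⊆ ⋃ p : htf.toFinset, D ∩ Metric.ball (p : Space 2) δ := by
    intro x hx
    obtain ⟨p, hp, hxp⟩ := Set.mem_iUnion₂.1 (ht (hDR hx))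
    exact Set.mem_iUnion.2 ⟨⟨p, htf.mem_toFinset.2 hp⟩, hx, hxp⟩
  refine (lintegral_mono_set hcover).trans ((lintegral_iUnion_le _ _).trans ?_)
  rw [tsum_fintype, Finset.sum_mul, Finset.sum_coe_sort htf.toFinset
    (fun p => ∫⁻ x in D ∩ Metric.ball p δ, ‖w x - w !₂[o 0, b]‖ₑ ^ 2)]
  exact Finset.sum_le_sum fun p _ => hloc p D w V hDm hD hoD hDR hw hV a a' b ha ha' hb' h1 h2 h3

/-- On an interval, the oscillation is at most the total variation. -/
theorem exists_poincare_smooth_line (R : ℝ) :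
    ∃ C : ℝ≥0∞, C ≠ ⊤ ∧ ∀ (D : Set (Space 1)) (w : Space 1 → ℝ) (V : ℝ≥0∞), MeasurableSet D →
      Convex ℝ D → D.Nonempty → D ⊆ Metric.closedBall 0 R → ContDiff ℝ 1 w →
      (∀ e, ∫⁻ x in D, ‖fderiv ℝ w x e‖ₑ ≤ ‖e‖ₑ * V) →
      ∃ c : ℝ, ∫⁻ x in D, ‖w x - c‖ₑ ^ 2 ≤ C * V ^ 2 := by
  set E : Space 1 := EuclideanSpace.single 0 1 with hE
  have hx : ∀ x : Space 1, x = x 0 • E := fun x => by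
    ext i; fin_cases i; simp [hE]
  have hE0 : E ≠ 0 := fun h => by simpa [hE] using congrArg (fun y : Space 1 => y 0) h
  set Φ : ℝ ≃L[ℝ] Space 1 := (LinearEquiv.ofInjectiveOfFinrankEq
    (LinearMap.toSpanSingleton ℝ (Space 1) E)
    (smul_left_injective ℝ hE0) (by simp)).toContinuousLinearEquiv with hΦ
  have hΦa : ∀ s : ℝ, Φ s = s • E := fun s => rfl
  obtain ⟨κ, h0, h1, h2⟩ := exists_lintegral_eq_mul_lintegral_comp Φ
  set k := κ⁻¹ * ‖E‖ₑ with hk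
  have hkt : k ≠ ⊤ := ENNReal.mul_ne_top (by simpa using h0) enorm_ne_top
  refine ⟨k ^ 2 * volume (Metric.closedBall (0 : Space 1) R),
    ENNReal.mul_ne_top (by finiteness) measure_closedBall_lt_top.ne,
    fun D w V hDm hD hne hDR hw hV => ?_⟩
  obtain ⟨y, hy⟩ := hne
  have hline : ∀ x, lineVariation D w E x ≤ k * V := by
    intro x
    rw [hx x, ← zero_add (x 0 • E), lineVariation_add_smul]
    have h := h2 _ (measurable_indicator_enorm_fderiv hDm hw E)
    rw [lintegral_indicator hDm] at h
    have h3 : lineVariation D w E 0 = κ⁻¹ * ∫⁻ x in D, ‖fderiv ℝ w x E‖ₑ := by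
      rw [h, ← mul_assoc, ENNReal.inv_mul_cancel h0 h1, one_mul]
      simp only [lineVariation, zero_add, hΦa]
    rw [h3, hk, mul_assoc]
    gcongr
    exact hV E
  refine ⟨w y, ?_⟩
  calc ∫⁻ x in D, ‖w x - w y‖ₑ ^ 2 ≤ ∫⁻ x in D, (k * V) ^ 2 := by
        refine setLIntegral_mono' hDm fun x hxD => ?_
        have e1 : x = y + (x - y) 0 • E := by rw [← hx]; abel
        have h := enorm_sub_le_lineVariation hD hw (x := y) (e := E) (t := (x - y) 0) hy
          (by rwa [← e1])
        rw [← e1] at h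
        gcongr
        exact h.trans (hline y)
    _ = (k * V) ^ 2 * volume D := by rw [setLIntegral_const]
    _ ≤ (k * V) ^ 2 * volume (Metric.closedBall (0 : Space 1) R) := by gcongr
    _ = _ := by ring

theorem exists_poincare_smooth {n : ℕ} (hn : n ≤ 2) (o : Space n) {r : ℝ} (hr : 0 < r) (R : ℝ) :
    ∃ C : ℝ≥0∞, C ≠ ⊤ ∧ ∀ (D : Set (Space n)) (w : Space n → ℝ) (V : ℝ≥0∞), MeasurableSet D →
      Convex ℝ D → Metric.ball o r ⊆ D → D ⊆ Metric.closedBall 0 R → ContDiff ℝ 1 w →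
      (∀ e, ∫⁻ x in D, ‖fderiv ℝ w x e‖ₑ ≤ ‖e‖ₑ * V) →
      ∃ c : ℝ, ∫⁻ x in D, ‖w x - c‖ₑ ^ 2 ≤ C * V ^ 2 := by
  interval_cases n
  · refine ⟨0, by simp, fun D w V _ _ _ _ _ _ => ⟨w 0, ?_⟩⟩
    have : ∀ x : Space 0, w x = w 0 := fun x => by rw [Subsingleton.elim x 0]
    simp [this]
  · obtain ⟨C, hC, h⟩ := exists_poincare_smooth_line R
    exact ⟨C, hC, fun D w V hDm hD hoD => h D w V hDm hD ⟨o, hoD (Metric.mem_ball_self hr)⟩⟩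
  · exact exists_poincare_smooth_plane o hr R

/-! ### Mollification of functions of bounded variation -/

/-- The inner parallel set `{x : closedBall x δ ⊆ Ω}`. -/
def innerParallel {n : ℕ} (Ω : Set (Space n)) (δ : ℝ) : Set (Space n) :=
  {x | ∀ y, ‖y‖ ≤ δ → x + y ∈ Ω}

theorem innerParallel_subset {n : ℕ} (Ω : Set (Space n)) {δ : ℝ} (hδ : 0 ≤ δ) :
    innerParallel Ω δ ⊆ Ω := fun x hx => by simpa using hx 0 (by simpa)

theorem convex_innerParallel {n : ℕ} {Ω : Set (Space n)} (hΩ : Convex ℝ Ω) (δ : ℝ) :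
    Convex ℝ (innerParallel Ω δ) := by
  intro x hx y hy a b ha hb hab v hv
  have h := hΩ (hx v hv) (hy v hv) ha hb hab
  have e : a • (x + v) + b • (y + v) = a • x + b • y + v := by
    have : v = a • v + b • v := by rw [← add_smul, hab, one_smul]
    nth_rw 3 [this]
    simp only [smul_add]
    abel
  rwa [e] at h

theorem isOpen_innerParallel {n : ℕ} {Ω : Set (Space n)} (hΩ : IsOpen Ω) {δ : ℝ} (hδ : 0 ≤ δ) :
    IsOpen (innerParallel Ω δ) := by
  have : innerParallel Ω δ = (Metric.cthickening δ Ωᶜ)ᶜ := by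
    rw [hΩ.isClosed_compl.cthickening_eq_biUnion_closedBall hδ]
    ext x
    simp only [innerParallel, Set.mem_ofPred_eq, Set.mem_compl_iff, Set.mem_iUnion,
      Metric.mem_closedBall, not_exists, exists_prop, not_and, dist_eq_norm]
    constructor
    · intro h y hy hxy
      refine hy ?_
      have := h (y - x) (by rwa [norm_sub_rev])
      simpa using this
    · intro h y hy
      by_contra hxy
      exact h (x + y) hxy (by simpa using hy)
  rw [this]
  exact Metric.isClosed_cthickening.isOpen_compl

theorem eventually_mem_innerParallel {n : ℕ} {Ω : Set (Space n)} (hΩ : IsOpen Ω) {x : Space n}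
    (hx : x ∈ Ω) {ι : Type*} {l : Filter ι} {δ : ι → ℝ} (hδ : Tendsto δ l (𝓝 0)) :
    ∀ᶠ i in l, x ∈ innerParallel Ω (δ i) := by
  obtain ⟨r, hr, hball⟩ := Metric.isOpen_iff.1 hΩ x hx
  filter_upwards [hδ.eventually (gt_mem_nhds hr)] with i hi y hy
  exact hball (by simpa using hy.trans_lt hi)

theorem fderiv_convolution_left_apply {n : ℕ} {ρ f : Space n → ℝ} (hρc : HasCompactSupport ρ)
    (hρ : ContDiff ℝ 1 ρ) (hf : LocallyIntegrable f volume) (x e : Space n) :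
    fderiv ℝ (ρ ⋆[ContinuousLinearMap.lsmul ℝ ℝ, volume] f) x e
      = ∫ t, fderiv ℝ ρ (x - t) e * f t := by
  rw [(hρc.hasFDerivAt_convolution_left (ContinuousLinearMap.lsmul ℝ ℝ) hρ hf x).fderiv,
    convolution_eq_swap, ContinuousLinearMap.integral_apply]
  · rfl
  · exact ((hρc.fderiv ℝ).convolutionExists_left _
      (hρ.continuous_fderiv one_ne_zero) hf x).integrable_swap

/-- Differentiation of a mollification passes to the other factor, with a sign, when the
mollifier is even. -/
theorem integral_mul_fderiv_convolution {n : ℕ} {ρ s g : Space n → ℝ}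
    (hρc : HasCompactSupport ρ) (hρ : ContDiff ℝ 1 ρ) (heven : ∀ x, ρ (-x) = ρ x)
    (hs : Integrable s volume) (hg : Integrable g volume) (e : Space n) :
    ∫ x, s x * fderiv ℝ (ρ ⋆[ContinuousLinearMap.lsmul ℝ ℝ, volume] g) x e =
      -∫ t, g t * fderiv ℝ (ρ ⋆[ContinuousLinearMap.lsmul ℝ ℝ, volume] s) t e := by
  have hodd : ∀ x, fderiv ℝ ρ (-x) e = -fderiv ℝ ρ x e := by
    intro x
    have h1 : (fun y => ρ (-y)) = ρ := funext heven
    have h2 : HasFDerivAt (fun y => ρ (-y)) ((fderiv ℝ ρ (-x)).comp (-ContinuousLinearMap.id ℝ _))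
        x := ((hρ.differentiable one_ne_zero (-x)).hasFDerivAt).comp x (hasFDerivAt_id x).neg
    rw [h1] at h2
    rw [h2.fderiv]
    simp
  have hcont : Continuous fun x => fderiv ℝ ρ x e :=
    (hρ.continuous_fderiv one_ne_zero).clm_apply continuous_const
  obtain ⟨M, hM⟩ : ∃ M, ∀ x, ‖fderiv ℝ ρ x e‖ ≤ M := by
    refine hcont.bounded_above_of_compact_support ?_
    exact hρc.fderiv_apply ℝ e
  have hint : Integrable (Function.uncurry fun x t => s x * (fderiv ℝ ρ (x - t) e * g t))
      (volume.prod volume) := by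
    have h1 : Integrable (fun p : Space n × Space n => s p.1 * g p.2) (volume.prod volume) :=
      hs.mul_prod hg
    have h2 := h1.bdd_mul (c := M) (f := fun p : Space n × Space n => fderiv ℝ ρ (p.1 - p.2) e)
      (hcont.comp (by fun_prop)).aestronglyMeasurable (ae_of_all _ fun p => hM _)
    refine h2.congr (ae_of_all _ fun p => ?_)
    simp only [Function.uncurry]
    ring
  simp only [fderiv_convolution_left_apply hρc hρ hg.locallyIntegrable,
    fderiv_convolution_left_apply hρc hρ hs.locallyIntegrable, ← integral_const_mul]
  rw [integral_integral_swap hint, ← integral_neg]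
  refine integral_congr_ae (ae_of_all _ fun t => ?_)
  simp only [← integral_neg]
  refine integral_congr_ae (ae_of_all _ fun x => ?_)
  have := hodd (x - t)
  rw [neg_sub] at this
  simp only [this]
  ring

theorem divergence_smul_const {n : ℕ} {h : Space n → ℝ} (hh : Differentiable ℝ h) (e x : Space n) :
    divergence (fun y => h y • e) x = fderiv ℝ h x e := by
  have h1 : fderiv ℝ (fun y => h y • e) x = (fderiv ℝ h x).smulRight e :=
    fderiv_smul_const (hh x) e
  have h2 : e = ∑ i, e i • EuclideanSpace.single i (1 : ℝ) := by
    ext j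
    simp [Finset.sum_apply, Pi.single_apply]
  conv_rhs => rw [h2]
  simp only [divergence, h1, map_sum, map_smul, ContinuousLinearMap.smulRight_apply,
    PiLp.smul_apply, smul_eq_mul]
  exact Finset.sum_congr rfl fun i _ => mul_comm _ _

theorem J0_nonneg {n : ℕ} (A : Set (Space n)) (u : Space n → ℝ) : 0 ≤ J0 A u := by
  refine le_iSup₂_of_le 0 ⟨⟨contDiff_const, HasCompactSupport.intro isCompact_empty
    fun x _ => rfl, by simp⟩, by simp⟩ ?_
  simp [divergence]

/-- Mollification does not increase the variation: on an inner parallel set the derivative of the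
mollified function in direction `e` has mass at most `‖e‖ J₀(u)`. Testing the derivative against
its own sign, the mollified sign is an admissible field on `Ω`. -/
theorem lintegral_fderiv_mollify_le {n : ℕ} {Ω : Set (Space n)} (ho : IsOpen Ω)
    (hb : Bornology.IsBounded Ω) {u : Space n → ℝ} (hu : IntegrableOn u Ω volume) {J : ℝ}
    (hJ : J0 Ω u ≤ J) (φ : ContDiffBump (0 : Space n)) (e : Space n) :
    ∫⁻ x in innerParallel Ω (2 * φ.rOut),
      ‖fderiv ℝ (φ.normed volume ⋆[ContinuousLinearMap.lsmul ℝ ℝ, volume] Ω.indicator u) x e‖ₑ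
        ≤ ‖e‖ₑ * ENNReal.ofReal J := by
  set ρ := φ.normed (volume : Measure (Space n)) with hρdef
  have hρc : HasCompactSupport ρ := φ.hasCompactSupport_normed
  have hρ : ContDiff ℝ 1 ρ := φ.contDiff_normed (n := 1)
  have hε := φ.rOut_pos
  set ε := φ.rOut with hεdef
  set D := innerParallel Ω (2 * ε) with hD
  have hDm : MeasurableSet D := (isOpen_innerParallel ho (by positivity)).measurableSet
  have hDΩ : D ⊆ Ω := innerParallel_subset Ω (by positivity)
  have hg : Integrable (Ω.indicator u) volume := (integrable_indicator_iff ho.measurableSet).2 hu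
  set w := ρ ⋆[ContinuousLinearMap.lsmul ℝ ℝ, volume] Ω.indicator u with hw
  have hwC : ContDiff ℝ 1 w := hρc.contDiff_convolution_left (n := 1) _ hρ hg.locallyIntegrable
  have hwe : Continuous fun x => fderiv ℝ w x e :=
    (hwC.continuous_fderiv one_ne_zero).clm_apply continuous_const
  -- the sign of the derivative, cut off outside `D`
  set s : Space n → ℝ := D.indicator fun x => if 0 ≤ fderiv ℝ w x e then 1 else -1 with hs
  have hsm : Measurable s := by
    refine (Measurable.ite ?_ measurable_const measurable_const).indicator hDm
    exact measurableSet_le measurable_const hwe.measurable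
  have hs1 : ∀ x, ‖s x‖ ≤ 1 := by
    intro x
    by_cases hx : x ∈ D
    · simp only [hs, Set.indicator_of_mem hx]
      split_ifs <;> simp
    · simp [hs, hx]
  have hDfin : volume D ≠ ⊤ := ((measure_mono hDΩ).trans_lt hb.measure_lt_top).ne
  have hsint : Integrable s volume := by
    have : IntegrableOn s D volume := by
      refine Measure.integrableOn_of_bounded hDfin hsm.aestronglyMeasurable (M := 1) ?_
      exact ae_of_all _ hs1
    refine this.integrable_of_forall_notMem_eq_zero fun x hx => ?_
    simp [hs, hx]
  have hsabs : ∀ x, s x * fderiv ℝ w x e = D.indicator (fun x => ‖fderiv ℝ w x e‖) x := by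
    intro x
    by_cases hx : x ∈ D
    · simp only [hs, Set.indicator_of_mem hx, Real.norm_eq_abs]
      split_ifs with h0
      · rw [abs_of_nonneg h0, one_mul]
      · rw [abs_of_neg (not_le.1 h0), neg_one_mul]
    · simp [hs, hx]
  set h := ρ ⋆[ContinuousLinearMap.lsmul ℝ ℝ, volume] s with hh
  have hhC : ContDiff ℝ 1 h := hρc.contDiff_convolution_left (n := 1) _ hρ hsint.locallyIntegrable
  have hh1 : ∀ x, |h x| ≤ 1 := by
    intro x
    have h1 : ‖h x‖ ≤ ∫ t, ρ t := by
      rw [hh, convolution_def]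
      refine norm_integral_le_of_norm_le φ.integrable_normed (ae_of_all _ fun t => ?_)
      rw [ContinuousLinearMap.lsmul_apply, norm_smul, Real.norm_of_nonneg (φ.nonneg_normed t)]
      exact mul_le_of_le_one_right (φ.nonneg_normed t) (hs1 _)
    rwa [hρdef, φ.integral_normed] at h1
  -- `D` has distance at least `2ε` from the complement of `Ω`, and mollifying uses up only `ε`
  have hsupp : tsupport h ⊆ (Metric.thickening ε Ωᶜ)ᶜ := by
    refine closure_minimal ?_ Metric.isOpen_thickening.isClosed_compl
    refine (support_convolution_subset _).trans ?_
    rintro y ⟨p, hp, q, hq, rfl⟩ hy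
    rw [hρdef, φ.support_normed_eq] at hp
    have hqD : q ∈ D := by
      by_contra hqD
      exact hq (by simp [hs, hqD])
    obtain ⟨z, hz, hyz⟩ := Metric.mem_thickening_iff.1 hy
    refine hz ?_
    have e1 : z = q + (z - q) := by abel
    rw [e1]
    refine hqD _ ?_
    have e2 : z - q = p - (p + q - z) := by abel
    rw [e2]
    refine (norm_sub_le _ _).trans ?_
    have h1 : ‖p‖ < ε := by simpa using hp
    have h2 : ‖p + q - z‖ < ε := by simpa [dist_eq_norm] using hyz
    linarith
  have hsuppΩ : tsupport h ⊆ Ω := hsupp.trans fun x hx => by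
    by_contra hxΩ
    exact hx (Metric.self_subset_thickening hε _ hxΩ)
  have hhc : HasCompactSupport h :=
    Metric.isCompact_of_isClosed_isBounded (isClosed_tsupport h) (hb.subset hsuppΩ)
  have hInt : ∫ x, s x * fderiv ℝ w x e = -∫ t, Ω.indicator u t * fderiv ℝ h t e :=
    integral_mul_fderiv_convolution hρc hρ (fun x => φ.normed_neg x) hsint hg e
  have hmain : ∫ x in D, ‖fderiv ℝ w x e‖ ≤ ‖e‖ * J := by
    rcases eq_or_ne e 0 with rfl | he
    · simp
    have hepos : 0 < ‖e‖ := norm_pos_iff.2 he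
    set c := ‖e‖⁻¹ with hc
    have hfield : (fun y => (c * h y) • e) ∈ fields Ω := by
      refine ⟨⟨(contDiff_const.mul hhC).smul contDiff_const, ?_, ?_⟩, fun x _ => ?_⟩
      · exact (hhc.mul_left (f := fun _ => c)).smul_right
      · refine (closure_mono ?_).trans hsuppΩ
        intro x hx hx0
        exact hx (by simp [hx0])
      · rw [norm_smul, norm_mul, Real.norm_eq_abs, Real.norm_eq_abs, hc, abs_inv, abs_norm,
          mul_right_comm, inv_mul_cancel₀ hepos.ne', one_mul]
        exact hh1 x
    have hle := (le_iSup₂ (f := fun ν (_ : ν ∈ fields Ω) =>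
      ((∫ x in Ω, -(u x) * divergence ν x : ℝ) : EReal)) _ hfield).trans hJ
    rw [EReal.coe_le_coe_iff] at hle
    have hdiv : ∀ x, divergence (fun y => (c * h y) • e) x = c * fderiv ℝ h x e := fun x => by
      have hd := hhC.differentiable one_ne_zero
      rw [divergence_smul_const (hd.const_mul c)]
      have : fderiv ℝ (fun y => c * h y) x = c • fderiv ℝ h x := fderiv_const_mul (hd x) c
      rw [this]
      rfl
    have hEq : ∫ x in Ω, -(u x) * divergence (fun y => (c * h y) • e) x
        = c * ∫ x in D, ‖fderiv ℝ w x e‖ := by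
      rw [← integral_indicator hDm, ← integral_indicator ho.measurableSet]
      simp only [← hsabs, hInt]
      rw [← integral_neg, ← integral_const_mul]
      refine integral_congr_ae (ae_of_all _ fun x => ?_)
      by_cases hx : x ∈ Ω
      · simp only [Set.indicator_of_mem hx, hdiv]
        ring
      · simp [hx]
    rw [hEq, hc, inv_mul_le_iff₀ hepos] at hle
    exact hle
  have hDint : Integrable (fun x => fderiv ℝ w x e) (volume.restrict D) := by
    obtain ⟨R, hR⟩ := hb.subset_closedBall (0 : Space n)
    exact (hwe.continuousOn.integrableOn_compact (isCompact_closedBall (0 : Space n) R)).mono_set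
      (hDΩ.trans hR)
  rw [← ofReal_integral_norm_eq_lintegral_enorm hDint, ← ofReal_norm,
    ← ENNReal.ofReal_mul (norm_nonneg e)]
  exact ENNReal.ofReal_le_ofReal hmain

theorem enorm_sub_sq_le (a b c : ℝ) :
    ‖a - b‖ₑ ^ 2 ≤ 2 * (‖a - c‖ₑ ^ 2 + ‖b - c‖ₑ ^ 2) := by
  have h : ∀ x : ℝ, ‖x‖ₑ ^ 2 = ENNReal.ofReal (x ^ 2) := fun x => by
    rw [← ofReal_norm, ← ENNReal.ofReal_pow (norm_nonneg x), Real.norm_eq_abs, sq_abs]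
  rw [h, h, h, ← ENNReal.ofReal_add (sq_nonneg _) (sq_nonneg _),
    show (2 : ℝ≥0∞) = ENNReal.ofReal 2 by simp, ← ENNReal.ofReal_mul (by norm_num)]
  refine ENNReal.ofReal_le_ofReal ?_
  nlinarith [sq_nonneg ((a - c) + (b - c))]

/-- Control of `‖w - c‖` for some constant `c` controls the mean square oscillation, in which no
constant occurs. -/
theorem lintegral_lintegral_sub_sq_le {n : ℕ} {D : Set (Space n)}
    {w : Space n → ℝ} (hw : Measurable w) (c : ℝ) {B : ℝ≥0∞}
    (h : ∫⁻ x in D, ‖w x - c‖ₑ ^ 2 ≤ B) :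
    ∫⁻ y in D, ∫⁻ x in D, ‖w x - w y‖ₑ ^ 2 ≤ 4 * volume D * B := by
  have hm : Measurable fun x => ‖w x - c‖ₑ ^ 2 := (hw.sub_const c).enorm.pow_const 2
  calc ∫⁻ y in D, ∫⁻ x in D, ‖w x - w y‖ₑ ^ 2
      ≤ ∫⁻ y in D, ∫⁻ x in D, 2 * (‖w x - c‖ₑ ^ 2 + ‖w y - c‖ₑ ^ 2) := by
        gcongr with y x
        exact enorm_sub_sq_le _ _ _
    _ = ∫⁻ y in D, 2 * ((∫⁻ x in D, ‖w x - c‖ₑ ^ 2) + ‖w y - c‖ₑ ^ 2 * volume D) := by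
        congr 1 with y
        rw [lintegral_const_mul _ (hm.add_const _), lintegral_add_right _ measurable_const,
          setLIntegral_const]
    _ = 2 * ((∫⁻ x in D, ‖w x - c‖ₑ ^ 2) * volume D +
          (∫⁻ x in D, ‖w x - c‖ₑ ^ 2) * volume D) := by
        rw [lintegral_const_mul _ ((hm.mul_const _).const_add _),
          lintegral_add_right _ (hm.mul_const _), setLIntegral_const, lintegral_mul_const _ hm]
    _ ≤ 2 * (B * volume D + B * volume D) := by gcongr
    _ = _ := by ring

/-! ### The Poincaré–Sobolev inequality for functions of bounded variation -/

/-- The Poincaré–Sobolev inequality for functions of bounded variation on a bounded convex set of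
dimension at most two. The inequality for the mollified functions is passed to the limit by Fatou's
lemma in the mean square oscillation; a point `y` where the oscillation around `u y` is at most its
mean provides the constant `m = u y`. -/
theorem exists_lintegral_sub_sq_le {n : ℕ} (hn : n ≤ 2) {Ω : Set (Space n)} (ho : IsOpen Ω)
    (hb : Bornology.IsBounded Ω) (hconv : Convex ℝ Ω) (hne : Ω.Nonempty) :
    ∃ C : ℝ≥0∞, C ≠ ⊤ ∧ ∀ (u : Space n → ℝ) (J : ℝ), IntegrableOn u Ω volume → J0 Ω u ≤ J →
      ∃ m : ℝ, ∫⁻ x in Ω, ‖u x - m‖ₑ ^ 2 ≤ C * ENNReal.ofReal J ^ 2 := by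
  obtain ⟨o, hoΩ⟩ := hne
  obtain ⟨r, hr, hball⟩ : ∃ r > 0, Metric.ball o (3 * r) ⊆ Ω := by
    obtain ⟨r, hr, h⟩ := Metric.isOpen_iff.1 ho o hoΩ
    exact ⟨r / 3, by positivity, by rwa [mul_div_cancel₀ r (by norm_num)]⟩
  obtain ⟨R, hR⟩ := hb.subset_closedBall (0 : Space n)
  obtain ⟨C, hC, hpoinc⟩ := exists_poincare_smooth hn o hr R
  refine ⟨4 * C, by finiteness, fun u J hu hJ => ?_⟩
  have hvol0 : volume Ω ≠ 0 := (ho.measure_pos volume ⟨o, hoΩ⟩).ne'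
  have hvolt : volume Ω ≠ ⊤ := hb.measure_lt_top.ne
  have : IsFiniteMeasure (volume.restrict Ω) := ⟨by simpa using hb.measure_lt_top⟩
  set V := ENNReal.ofReal J
  set g := Ω.indicator u with hgdef
  have hg : Integrable g volume := (integrable_indicator_iff ho.measurableSet).2 hu
  have hpos : ∀ k : ℕ, 0 < r / ((k : ℝ) + 1) := fun k => by positivity
  set φ : ℕ → ContDiffBump (0 : Space n) := fun k =>
    ⟨r / ((k : ℝ) + 1) / 2, r / ((k : ℝ) + 1), half_pos (hpos k), half_lt_self (hpos k)⟩ with hφ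
  have hφ0 : Tendsto (fun k => (φ k).rOut) atTop (𝓝 0) := by
    have h : Tendsto (fun k : ℕ => r * (1 / ((k : ℝ) + 1))) atTop (𝓝 (r * 0)) :=
      tendsto_one_div_add_atTop_nhds_zero_nat.const_mul r
    simpa [hφ, div_eq_mul_inv] using h
  have hφr : ∀ k, (φ k).rOut ≤ r := fun k => div_le_self hr.le (by simp)
  set w : ℕ → Space n → ℝ := fun k =>
    (φ k).normed volume ⋆[ContinuousLinearMap.lsmul ℝ ℝ, volume] g with hw
  have hwC : ∀ k, ContDiff ℝ 1 (w k) := fun k =>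
    (φ k).hasCompactSupport_normed.contDiff_convolution_left (n := 1) _
      ((φ k).contDiff_normed (n := 1)) hg.locallyIntegrable
  have hwm : ∀ k, Measurable (w k) := fun k => (hwC k).continuous.measurable
  have hlim : ∀ᵐ x, Tendsto (fun k => w k x) atTop (𝓝 (g x)) :=
    ContDiffBump.ae_convolution_tendsto_right_of_locallyIntegrable (K := 2) hφ0
      (Eventually.of_forall fun k => by
        change r / ((k : ℝ) + 1) ≤ 2 * (r / ((k : ℝ) + 1) / 2)
        linarith) hg.locallyIntegrable
  set D : ℕ → Set (Space n) := fun k => innerParallel Ω (2 * (φ k).rOut) with hD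
  have hD0 : ∀ k, 0 ≤ 2 * (φ k).rOut := fun k => by have := (φ k).rOut_pos; positivity
  have hDΩ : ∀ k, D k ⊆ Ω := fun k => innerParallel_subset Ω (hD0 k)
  have hDm : ∀ k, MeasurableSet (D k) := fun k => (isOpen_innerParallel ho (hD0 k)).measurableSet
  have hDev : ∀ x ∈ Ω, ∀ᶠ k in atTop, x ∈ D k := fun x hx =>
    eventually_mem_innerParallel ho hx (by simpa using hφ0.const_mul 2)
  have hDball : ∀ k, Metric.ball o r ⊆ D k := by
    intro k x hx y hy
    refine hball ?_
    rw [Metric.mem_ball, dist_eq_norm] at hx ⊢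
    have e1 : x + y - o = (x - o) + y := by abel
    rw [e1]
    linarith [norm_add_le (x - o) y, hφr k]
  -- the mean square oscillation of the mollified functions
  set K : ℕ → Space n → ℝ≥0∞ := fun k =>
    (D k).indicator fun y => ∫⁻ x in D k, ‖w k x - w k y‖ₑ ^ 2 with hK
  have hKm : ∀ k, Measurable (K k) := fun k => by
    refine Measurable.indicator ?_ (hDm k)
    refine Measurable.lintegral_prod_right'
      (f := fun p : Space n × Space n => ‖w k p.2 - w k p.1‖ₑ ^ 2) ?_
    exact (((hwm k).comp measurable_snd).sub ((hwm k).comp measurable_fst)).enorm.pow_const 2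
  have hKle : ∀ k, ∫⁻ y, K k y ≤ 4 * volume Ω * (C * V ^ 2) := by
    intro k
    obtain ⟨c, hc⟩ := hpoinc (D k) (w k) V (hDm k) (convex_innerParallel hconv _) (hDball k)
      ((hDΩ k).trans hR) (hwC k) fun e => lintegral_fderiv_mollify_le ho hb hu hJ (φ k) e
    rw [lintegral_indicator (hDm k)]
    refine (lintegral_lintegral_sub_sq_le (hwm k) c hc).trans ?_
    gcongr
    exact hDΩ k
  have hfatou : ∫⁻ y in Ω, liminf (fun k => K k y) atTop ≤ 4 * volume Ω * (C * V ^ 2) :=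
    calc ∫⁻ y in Ω, liminf (fun k => K k y) atTop
        ≤ ∫⁻ y, liminf (fun k => K k y) atTop := setLIntegral_le_lintegral _ _
      _ ≤ liminf (fun k => ∫⁻ y, K k y) atTop := lintegral_liminf_le hKm
      _ ≤ liminf (fun _ : ℕ => 4 * volume Ω * (C * V ^ 2)) atTop :=
          liminf_le_liminf (Eventually.of_forall hKle)
      _ = _ := liminf_const _
  have hgood : ∀ᵐ y ∂volume.restrict Ω, y ∈ Ω ∧ Tendsto (fun k => w k y) atTop (𝓝 (g y)) :=
    (ae_restrict_mem ho.measurableSet).and (ae_restrict_of_ae hlim)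
  obtain ⟨y, hy, hyle⟩ := exists_notMem_null_le_laverage
    (μ := volume.restrict Ω) (f := fun y => liminf (fun k => K k y) atTop)
    (by rwa [Ne, Measure.restrict_eq_zero]) (Measurable.liminf hKm).aemeasurable
    (ae_iff.1 hgood)
  obtain ⟨hyΩ, hylim⟩ : y ∈ Ω ∧ Tendsto (fun k => w k y) atTop (𝓝 (g y)) := not_not.1 hy
  refine ⟨u y, ?_⟩
  calc ∫⁻ x in Ω, ‖u x - u y‖ₑ ^ 2
      ≤ ∫⁻ x in Ω, liminf (fun k => (D k).indicator (fun x => ‖w k x - w k y‖ₑ ^ 2) x) atTop := by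
        refine lintegral_mono_ae ?_
        filter_upwards [hgood] with x hx
        have h1 : Tendsto (fun k => ‖w k x - w k y‖ₑ ^ 2) atTop (𝓝 (‖g x - g y‖ₑ ^ 2)) :=
          ((ENNReal.continuous_pow 2).tendsto _).comp (hx.2.sub hylim).enorm
        have h2 : Tendsto (fun k => (D k).indicator (fun x => ‖w k x - w k y‖ₑ ^ 2) x) atTop
            (𝓝 (‖g x - g y‖ₑ ^ 2)) := by
          refine h1.congr' ?_
          filter_upwards [hDev x hx.1] with k hk
          rw [Set.indicator_of_mem hk]
        rw [h2.liminf_eq, hgdef, Set.indicator_of_mem hx.1, Set.indicator_of_mem hyΩ]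
    _ ≤ liminf (fun k => ∫⁻ x in Ω, (D k).indicator (fun x => ‖w k x - w k y‖ₑ ^ 2) x) atTop :=
        lintegral_liminf_le fun k =>
          (((hwm k).sub_const _).enorm.pow_const 2).indicator (hDm k)
    _ ≤ liminf (fun k => K k y) atTop := by
        refine liminf_le_liminf ?_
        filter_upwards [hDev y hyΩ] with k hk
        rw [hK]
        simp only [Set.indicator_of_mem hk]
        rw [← lintegral_indicator (hDm k)]
        exact setLIntegral_le_lintegral _ _
    _ ≤ (4 * volume Ω * (C * V ^ 2)) / volume Ω := by
        refine hyle.trans ?_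
        rw [setLAverage_eq]
        gcongr
    _ = 4 * C * V ^ 2 := by
        rw [mul_assoc, mul_comm (volume Ω), ← mul_assoc, ENNReal.mul_div_cancel_right hvol0 hvolt,
          mul_assoc]

/-- The Poincaré–Sobolev inequality in terms of the norm of `L²(Ω)`. -/
theorem exists_norm_sub_smul_chi_le {n : ℕ} (hn : n ≤ 2) {Ω : Set (Space n)} (ho : IsOpen Ω)
    (hb : Bornology.IsBounded Ω) (hconv : Convex ℝ Ω) (hne : Ω.Nonempty) :
    ∃ C : ℝ, ∀ (u : L2 Ω) (J : ℝ), J0 Ω u ≤ J → ∃ m : ℝ, ‖u - m • chi ho hb‖ ≤ C * J := by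
  obtain ⟨C, hC, h⟩ := exists_lintegral_sub_sq_le hn ho hb hconv hne
  refine ⟨√C.toReal, fun u J hJ => ?_⟩
  have hJ0 : 0 ≤ J := EReal.coe_nonneg.1 ((J0_nonneg Ω u).trans hJ)
  obtain ⟨m, hm⟩ := h u J (integrableOn_of_L2 hb u) hJ
  refine ⟨m, ?_⟩
  have hae : (u - m • chi ho hb : L2 Ω) =ᵐ[volume.restrict Ω] fun x => u x - m := by
    filter_upwards [Lp.coeFn_sub u (m • chi ho hb), Lp.coeFn_smul m (chi ho hb),
      indicatorConstLp_coeFn (p := 2) (hs := ho.measurableSet) (hμs := restrict_self_ne_top hb)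
        (c := (1 : ℝ)), ae_restrict_mem ho.measurableSet] with x h1 h2 h3 h4
    have h3' : chi ho hb x = 1 := by
      rw [chi, h3, Set.indicator_of_mem h4]
    rw [h1, Pi.sub_apply, h2, Pi.smul_apply, h3', smul_eq_mul, mul_one]
  have hsq : ‖u - m • chi ho hb‖ₑ ^ 2 ≤ C * ENNReal.ofReal J ^ 2 := by
    refine le_trans (le_of_eq ?_) hm
    rw [Lp.enorm_def, eLpNorm_congr_ae hae, eLpNorm_eq_lintegral_rpow_enorm_toReal two_ne_zero
      ENNReal.ofNat_ne_top, ← ENNReal.rpow_natCast, ← ENNReal.rpow_mul]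
    simp
  have hreal := ENNReal.toReal_mono (by finiteness) hsq
  rw [ENNReal.toReal_pow, toReal_enorm, ENNReal.toReal_mul, ENNReal.toReal_pow,
    ENNReal.toReal_ofReal hJ0] at hreal
  refine abs_le_of_sq_le_sq' ?_ (by positivity) |>.2
  rw [mul_pow, Real.sq_sqrt ENNReal.toReal_nonneg]
  exact hreal

end L2BV

/-! ### Existence and uniqueness of minimizers -/

theorem mainTheorem4 {n : ℕ} (hn : n ≤ 2)
    (Ω : Set (L2BV.Space n)) (hopen : IsOpen Ω) (hbdd : Bornology.IsBounded Ω)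
    (hconv : Convex ℝ Ω)
    {Y : Type*} [NormedAddCommGroup Y] [NormedSpace ℝ Y]
    (T : L2BV.L2 Ω →L[ℝ] Y) (v : Y) (α₁ α₂ : ℝ) (hα₁ : 0 < α₁) (hα₂ : 0 < α₂)
    (θ : L2BV.Space n → ℝ) (hθ_meas : AEMeasurable θ (volume.restrict Ω))
    (hθ : ∀ x ∈ Ω, θ x ∈ Set.Icc (0 : ℝ) 1)
    (hθ_inv : ∃ K : ℝ, ∀ x ∈ Ω \ L2BV.regionOne Ω θ, 0 < θ x ∧ 1 / θ x ≤ K)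
    (hθ_int : IntegrableOn (fun x => 1 / (1 - θ x)) (Ω \ L2BV.regionOne Ω θ) volume)
    (hT : T (L2BV.chi hopen hbdd) ≠ 0) :
    (∃ u : L2BV.L2 Ω,
      (∀ w : L2BV.L2 Ω, L2BV.F Ω T v α₁ α₂ θ u ≤ L2BV.F Ω T v α₁ α₂ θ w) ∧
      L2BV.MemBV (Ω \ L2BV.regionOne Ω θ) u ∧ L2BV.MemBV Ω u) ∧
    (StrictConvexSpace ℝ Y →
      (∀ u : L2BV.L2 Ω, T u = 0 →
        (∀ᵐ x ∂volume, x ∈ Ω \ L2BV.regionOne Ω θ → u x = 0) → u = 0) →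
      ∃! u : L2BV.L2 Ω,
        ∀ w : L2BV.L2 Ω, L2BV.F Ω T v α₁ α₂ θ u ≤ L2BV.F Ω T v α₁ α₂ θ w) := by
  have hΩm := hopen.measurableSet
  -- off `Ω₁` the bound on `1 / θ` applies, and on `Ω₁` the weight is `1`
  obtain ⟨c, hc, hθc⟩ : ∃ c : ℝ, 0 < c ∧ ∀ x ∈ Ω, c ≤ θ x := by
    obtain ⟨K, hK⟩ := hθ_inv
    refine ⟨1 / max K 1, by positivity, fun x hx => ?_⟩
    by_cases h1 : θ x = 1
    · rw [h1]
      exact (div_le_one (by positivity)).2 (le_max_right _ _)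
    · obtain ⟨hpos, hle⟩ := hK x ⟨hx, fun h => h1 h.2⟩
      rw [one_div_le (by positivity) hpos]
      exact hle.trans (le_max_left _ _)
  -- for empty `Ω` the space `L²(Ω)` is trivial, which `T χ_Ω ≠ 0` rules out
  have hne : Ω.Nonempty := by
    by_contra h
    obtain rfl := Set.not_nonempty_iff_eq_empty.1 h
    refine hT ?_
    have h0 : L2BV.chi hopen hbdd = 0 := by
      exact Lp.ext ((ae_restrict_iff' hΩm).2 (ae_of_all _ fun _ hx => hx.elim))
    rw [h0, map_zero]
  obtain ⟨C, hC⟩ := L2BV.exists_norm_sub_smul_chi_le hn hopen hbdd hconv hne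
  have hF0 := L2BV.F_zero_lt_top hΩm T v α₁ hα₂ hθ_meas hθ
  obtain ⟨u, hu⟩ := exists_minimizer_of_sublevel
    (L2BV.isClosed_sublevel_F hΩm T v α₁ hα₂ hθ_meas hθ)
    (L2BV.convex_sublevel_F hΩm T v hα₁ hα₂ hθ_meas hθ)
    (L2BV.isBounded_sublevel_F hopen hbdd hT v hα₁ hα₂ hc hθc hC)
    (L2BV.F_nonneg T v hα₁ hα₂ θ) hF0
  refine ⟨⟨u, hu, ?_⟩, fun _ hker => ⟨u, hu, fun w hw => ?_⟩⟩
  · have hFu := (hu 0).trans_lt hF0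
    have hFu' : L2BV.F Ω T v α₁ α₂ θ u ≤ (L2BV.F Ω T v α₁ α₂ θ u).toReal :=
      EReal.le_coe_toReal hFu.ne
    have hJ : L2BV.J0 Ω u < ⊤ :=
      (L2BV.J0_le_of_F_le hα₁ hα₂ hc hθc hFu').trans_lt (EReal.coe_lt_top _)
    have hI := L2BV.integrableOn_of_L2 hbdd u
    exact ⟨⟨hI.mono_set Set.sdiff_subset,
      (L2BV.J0_mono hΩm Set.sdiff_subset u).trans_lt hJ⟩, hI, hJ⟩
  · obtain ⟨hTeq, hae⟩ := L2BV.minimizers_agree hΩm hα₁ hα₂ hθ_meas hθ hw hu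
    exact sub_eq_zero.1 (hker (w - u) (by rw [map_sub, hTeq, sub_self]) hae)
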